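/- **Theorem (Horn from entailments; Frazier and Pitt).** The learning framework $\mathfrak F(\mathrm{HORN}_{\mathcal E})$, i.e. learning propositional Horn sentences from entailments, is polynomial time exactly learnable. Definitions. Let $V$ be a finite set of propositional variables. A Horn clause over $V$ is a clause with at most one unnegated literal, and a Horn sentence over $V$ is a finite conjunction of Horn clauses over $V$. In $\mathfrak F(\mathrm{HORN}_{\mathcal E})=(E_{\mathcal E},\mathcal L_{\mathsf H},\mu_{\mathcal E})$, the set $E_{\mathcal E}$ of examples consists of all Horn clauses over $V$, the set $\mathcal L_{\mathsf H}$ of concept representations consists of all Horn sentences over $V$, and $\mu_{\mathcal E}(\mathcal T)=\{c\in E_{\mathcal E} : \mathcal T\models c\}$. A learner for an unknown target $\mathcal T\in\mathcal L_{\mathsf H}$ may ask membership queries (for $c\in E_{\mathcal E}$: does $c\in\mu_{\mathcal E}(\mathcal T)$ hold?) and equivalence queries (for $\mathcal H\in\mathcal L_{\mathsf H}$: the answer is "yes" if $\mu_{\mathcal E}(\mathcal H)=\mu_{\mathcal E}(\mathcal T)$, and otherwise an arbitrary counterexample $e\in\mu_{\mathcal E}(\mathcal H)\oplus\mu_{\mathcal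 E}(\mathcal T)$). The theorem states that there are a single deterministic algorithm $A$, which receives $V$ as input, and a polynomial $p$ such that for every finite $V$, every target Horn sentence $\mathcal T$ over $V$, and all choices of counterexamples by the equivalence oracle, $A$ halts and outputs a Horn sentence $\mathcal T'$ over $V$ with $\mu_{\mathcal E}(\mathcal T')=\mu_{\mathcal E}(\mathcal T)$, and at every step of the computation the time used up to that step is at most $p(|\mathcal T|,|e|)$, where $e$ is the largest counterexample seen so far ($|e|=0$ if there is none yet). Here the length of a clause is its number of literals plus one, and the length of a Horn sentence over $V$ is $|V|$ plus the sum of the lengths of its clauses. Time is counted on a pointer machine over binary trees, where each elementary operation takes one unit of time, and each oracle call takes one unit plus the size of the query. -/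

import Mathlib

namespace HornLearning

/-! ### Data and programs: a pointer machine with oracle calls -/

/-- The values manipulated by programs: binary trees. -/
inductive Data : Type
  | nil : Data
  | cons : Data → Data → Data

namespace Data

/-- Number of nodes of a tree (leaves included). -/
def size : Data → ℕ
  | nil => 1
  | cons a b => a.size + b.size + 1

def head : Data → Data
  | nil => nil
  | cons a _ => a

def tail : Data → Data
  | nil => nil
  | cons _ b => b

def ofBool : Bool → Data
  | false => nil
  | true => cons nil nil

/-- A list of values as a right-nested tree. -/
def ofList : List Data → Data
  | [] => nil
  | a :: l => cons a (ofList l)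

/-- Natural numbers in unary. -/
def ofNat (k : ℕ) : Data := ofList (List.replicate k nil)

theorem ofBool_injective : Function.Injective ofBool := by
  intro a b h
  cases a <;> cases b <;> simp_all [ofBool]

theorem ofList_injective : Function.Injective ofList := by
  intro l
  induction l with
  | nil => intro m h; cases m <;> simp_all [ofList]
  | cons a l ih =>
    intro m h
    cases m with
    | nil => simp [ofList] at h
    | cons b m =>
      simp only [ofList, cons.injEq] at h
      rw [h.1, ih h.2]

theorem ofNat_injective : Function.Injective ofNat := by
  intro a b h
  simpa using congrArg List.length (ofList_injective h)

end Data

/-- Programs over registers `0, 1, 2, …`, each holding a tree. The only access to the target is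
through the two oracle instructions. -/
inductive Program : Type
  /-- `x := nil` -/
  | setNil (x : ℕ) : Program
  /-- `x := y` -/
  | copy (x y : ℕ) : Program
  /-- `x := cons y z` -/
  | setCons (x y z : ℕ) : Program
  /-- `x := head y` -/
  | setHead (x y : ℕ) : Program
  /-- `x := tail y` -/
  | setTail (x y : ℕ) : Program
  /-- first `p`, then `q` -/
  | seq (p q : Program) : Program
  /-- if `x` is not `nil` then `p` else `q` -/
  | ifte (x : ℕ) (p q : Program) : Program
  /-- while `x` is not `nil` do `p` -/
  | loop (x : ℕ) (p : Program) : Program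
  /-- `x :=` answer to the membership query held by `y` -/
  | askMem (x y : ℕ) : Program
  /-- `x :=` answer to the equivalence query held by `y` -/
  | askEq (x y : ℕ) : Program

/-! ### Learning frameworks -/

/-- A learning framework: examples, concept representations, the concept that each representation
denotes (the concept class is the range of `concept`), the lengths of examples and
representations, and lossless encodings of both as data. -/
structure LearningFramework : Type 1 where
  Example : Type
  Rep : Type
  concept : Rep → Set Example
  exampleSize : Example → ℕ
  repSize : Rep → ℕ
  encodeExample : Example → Data
  encodeRep : Rep → Data
  encodeExample_injective : Function.Injective encodeExample
  encodeRep_injective : Function.Injective encodeRep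

/-- A configuration of a run: the instructions still to be executed, the registers, the time used
so far, and the size of the largest counterexample seen so far (`0` if there is none yet). -/
structure Config : Type where
  todo : List Program
  reg : ℕ → Data
  time : ℕ
  maxCex : ℕ

open Classical in
/-- One step of computation with target `l`. Every instruction and every test takes one unit of
time; an oracle call takes in addition the size of the query (the time to write it out).
* A membership query `e` is answered by `true` or `false`.
* An equivalence query `h` is answered by `nil` ("yes") if `h` and `l` denote the same concept, and
  otherwise by the one-element list of an arbitrary example in the symmetric difference.

A call whose argument does not encode an object of the right kind has no successor. -/
inductive Step (F : LearningFramework) (l : F.Rep) : Config → Config → Prop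
  | setNil (x : ℕ) (k : List Program) (s : ℕ → Data) (t m : ℕ) :
      Step F l ⟨.setNil x :: k, s, t, m⟩ ⟨k, Function.update s x .nil, t + 1, m⟩
  | copy (x y : ℕ) (k : List Program) (s : ℕ → Data) (t m : ℕ) :
      Step F l ⟨.copy x y :: k, s, t, m⟩ ⟨k, Function.update s x (s y), t + 1, m⟩
  | setCons (x y z : ℕ) (k : List Program) (s : ℕ → Data) (t m : ℕ) :
      Step F l ⟨.setCons x y z :: k, s, t, m⟩
        ⟨k, Function.update s x (.cons (s y) (s z)), t + 1, m⟩
  | setHead (x y : ℕ) (k : List Program) (s : ℕ → Data) (t m : ℕ) :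
      Step F l ⟨.setHead x y :: k, s, t, m⟩ ⟨k, Function.update s x (s y).head, t + 1, m⟩
  | setTail (x y : ℕ) (k : List Program) (s : ℕ → Data) (t m : ℕ) :
      Step F l ⟨.setTail x y :: k, s, t, m⟩ ⟨k, Function.update s x (s y).tail, t + 1, m⟩
  | seq (p q : Program) (k : List Program) (s : ℕ → Data) (t m : ℕ) :
      Step F l ⟨.seq p q :: k, s, t, m⟩ ⟨p :: q :: k, s, t + 1, m⟩
  | ifTrue (x : ℕ) (p q : Program) (k : List Program) (s : ℕ → Data) (t m : ℕ)
      (hx : s x ≠ .nil) :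
      Step F l ⟨.ifte x p q :: k, s, t, m⟩ ⟨p :: k, s, t + 1, m⟩
  | ifFalse (x : ℕ) (p q : Program) (k : List Program) (s : ℕ → Data) (t m : ℕ)
      (hx : s x = .nil) :
      Step F l ⟨.ifte x p q :: k, s, t, m⟩ ⟨q :: k, s, t + 1, m⟩
  | loopTrue (x : ℕ) (p : Program) (k : List Program) (s : ℕ → Data) (t m : ℕ)
      (hx : s x ≠ .nil) :
      Step F l ⟨.loop x p :: k, s, t, m⟩ ⟨p :: .loop x p :: k, s, t + 1, m⟩
  | loopFalse (x : ℕ) (p : Program) (k : List Program) (s : ℕ → Data) (t m : ℕ)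
      (hx : s x = .nil) :
      Step F l ⟨.loop x p :: k, s, t, m⟩ ⟨k, s, t + 1, m⟩
  | askMem (x y : ℕ) (k : List Program) (s : ℕ → Data) (t m : ℕ)
      (e : F.Example) (he : s y = F.encodeExample e) :
      Step F l ⟨.askMem x y :: k, s, t, m⟩
        ⟨k, Function.update s x (Data.ofBool (decide (e ∈ F.concept l))),
          t + 1 + (s y).size, m⟩
  | askEqYes (x y : ℕ) (k : List Program) (s : ℕ → Data) (t m : ℕ)
      (h : F.Rep) (hh : s y = F.encodeRep h) (heq : F.concept h = F.concept l) :
      Step F l ⟨.askEq x y :: k, s, t, m⟩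
        ⟨k, Function.update s x .nil, t + 1 + (s y).size, m⟩
  | askEqNo (x y : ℕ) (k : List Program) (s : ℕ → Data) (t m : ℕ)
      (h : F.Rep) (hh : s y = F.encodeRep h)
      (e : F.Example) (he : e ∈ symmDiff (F.concept h) (F.concept l)) :
      Step F l ⟨.askEq x y :: k, s, t, m⟩
        ⟨k, Function.update s x (.cons (F.encodeExample e) .nil),
          t + 1 + (s y).size, max m (F.exampleSize e)⟩

/-- The initial configuration of program `P` on input `d`: the input is in register `0`. -/
def initial (P : Program) (d : Data) : Config :=
  ⟨[P], Function.update (fun _ => .nil) 0 d, 0, 0⟩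

/-- Polynomial time exact learnability of a family of frameworks, `F n` being the framework over
`n` variables. One deterministic program receives `n` in unary. Whatever counterexamples the
equivalence oracle chooses, it always halts, it ends with its output in register `0`, a
representation of the target concept, and at every step the time used so far (at the end, including
the time to write the output) is at most a polynomial in the size of the target and the size of the
largest counterexample seen so far. -/
def PolyTimeExactlyLearnable (F : ℕ → LearningFramework) : Prop :=
  ∃ (P : Program) (p : MvPolynomial (Fin 2) ℕ), ∀ (n : ℕ) (l : (F n).Rep),
    (¬ ∃ c : ℕ → Config, c 0 = initial P (Data.ofNat n) ∧ ∀ i, Step (F n) l (c i) (c (i + 1))) ∧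
    ∀ c : Config, Relation.ReflTransGen (Step (F n) l) (initial P (Data.ofNat n)) c →
      c.time ≤ MvPolynomial.eval ![(F n).repSize l, c.maxCex] p ∧
      ((¬ ∃ c', Step (F n) l c c') →
        c.todo = [] ∧
        (∃ h : (F n).Rep, c.reg 0 = (F n).encodeRep h ∧ (F n).concept h = (F n).concept l) ∧
        c.time + (c.reg 0).size ≤ MvPolynomial.eval ![(F n).repSize l, c.maxCex] p)

/-! ### Propositional Horn sentences -/

/-- A Horn clause over the variables `Fin n`, i.e. a clause with at most one unnegated literal:
`ant` is the set of variables that occur negated, and `head` the variable that occurs unnegated,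
if any (`none` is the constant false, as consequent of the implication). -/
@[ext] structure HornClause (n : ℕ) : Type where
  ant : Finset (Fin n)
  head : Option (Fin n)

/-- A Horn sentence: a conjunction of Horn clauses. -/
abbrev HornSentence (n : ℕ) : Type := List (HornClause n)

abbrev Interpretation (n : ℕ) : Type := Fin n → Bool

namespace HornClause

variable {n : ℕ}

/-- The interpretation `I` satisfies the clause `c`. -/
def Sat (I : Interpretation n) (c : HornClause n) : Prop :=
  (∃ v ∈ c.ant, I v = false) ∨ (∃ v, c.head = some v ∧ I v = true)

/-- Length of a clause: the number of its literals, plus one. -/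
def length (c : HornClause n) : ℕ := c.ant.card + c.head.toList.length + 1

/-- The antecedent is encoded by its `n` membership bits, the consequent by `nil` or by the
one-element list of the index of its variable. -/
def encode (c : HornClause n) : Data :=
  .cons (Data.ofList (List.ofFn fun v : Fin n => Data.ofBool (decide (v ∈ c.ant))))
    (Data.ofList (c.head.toList.map fun v => Data.ofNat v))

theorem encode_injective : Function.Injective (encode (n := n)) := by
  rintro ⟨a, h⟩ ⟨b, k⟩ hab
  simp only [encode, Data.cons.injEq] at hab
  have h1 := List.ofFn_injective (Data.ofList_injective hab.1)
  have h2 := Data.ofList_injective hab.2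
  ext1
  · ext v
    have := Data.ofBool_injective (congrFun h1 v)
    simpa using this
  · cases h <;> cases k <;> simp at h2
    · rfl
    · simp [Fin.ext (Data.ofNat_injective h2)]

end HornClause

namespace HornSentence

variable {n : ℕ}

def Sat (I : Interpretation n) (T : HornSentence n) : Prop := ∀ c ∈ T, HornClause.Sat I c

/-- Logical consequence `T ⊨ c`. -/
def Entails (T : HornSentence n) (c : HornClause n) : Prop :=
  ∀ I : Interpretation n, Sat I T → HornClause.Sat I c

/-- Length of a sentence over `n` variables: the number of variables plus the lengths of the
clauses. -/
def length (T : HornSentence n) : ℕ := n + (List.map HornClause.length T).sum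

def encode (T : HornSentence n) : Data := Data.ofList (List.map HornClause.encode T)

theorem encode_injective : Function.Injective (encode (n := n)) := fun _ _ h =>
  List.map_injective_iff.mpr HornClause.encode_injective (Data.ofList_injective h)

end HornSentence

/-- Learning Horn sentences over `n` variables from entailments: examples are Horn clauses, and a
sentence `T` denotes the set of Horn clauses that it entails. -/
def hornFromEntailments (n : ℕ) : LearningFramework where
  Example := HornClause n
  Rep := HornSentence n
  concept T := {c | HornSentence.Entails T c}
  exampleSize := HornClause.length
  repSize := HornSentence.length
  encodeExample := HornClause.encode
  encodeRep := HornSentence.encode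
  encodeExample_injective := HornClause.encode_injective
  encodeRep_injective := HornSentence.encode_injective

end HornLearning

/-! The learner keeps a list of sets of variables. Read as interpretations (the variables in the set
are true), each falsifies the target T. Its hypothesis H consists of all clauses `X → h` entailed by
T with `X` in the list and `h` a variable or falsum; membership queries find them. As T entails H,
every counterexample e is entailed by T but not by H.

Closing the antecedent of e under H by forward chaining gives a set x. Some model of H falsifies e;
it makes all of x true, so the head of e is not in x and x falsifies T, while x respects every
clause of H (`IsHypothesis.saturate_spec`). The first `X` in the list with `X ⊄ x` such that `X ∩ x`
still falsifies T is replaced by `X ∩ x`; if there is none, x is appended. Membership queries decide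
whether a set Y falsifies T: it does iff T entails from Y falsum or a variable outside Y
(`isNegative_iff_exists_entails`).

The invariant `Admissible` says that if A precedes B, then no clause of T falsified by B has its
antecedent inside A. Hence clauses of T falsified by different members are different, and the list
is no longer than T (`Admissible.length_le`). Refinement preserves the invariant
(`Admissible.refine`), since a Horn clause true in two sets is true in their intersection. Each
round shrinks a member or adds one, so the sum of `n + 1 - |X|` grows strictly
(`progress_lt_refine`); it is at most `|T| * (|T| + 1)`, which bounds the rounds.

For the running time, a Hoare logic with time bounds (`Triple`) is set up for the machine, and on
top of it a small language of expressions (`Ev`) in which the subroutines are written. `Good`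
quantifies over all oracle answers; termination, and a time bound at every step, follow from a bound
at the end of each run. -/

namespace HornLearning

/-! ### Total correctness of programs -/

/-- Every run from the configuration halts, with all instructions executed, in a configuration
satisfying `Φ`. -/
inductive Good (F : LearningFramework) (l : F.Rep) (Φ : Config → Prop) : Config → Prop
  | halt (c : Config) (h : c.todo = []) (hc : Φ c) : Good F l Φ c
  | step (c : Config) (h : ∃ c', Step F l c c') (hc : ∀ c', Step F l c c' → Good F l Φ c') :
      Good F l Φ c

theorem Step.todo_ne_nil {F : LearningFramework} {l : F.Rep} {c c' : Config}
    (h : Step F l c c') : c.todo ≠ [] := by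
  cases h <;> simp

theorem Step.time_le {F : LearningFramework} {l : F.Rep} {c c' : Config}
    (h : Step F l c c') : c.time ≤ c'.time := by
  cases h <;> simp only <;> omega

namespace Good

variable {F : LearningFramework} {l : F.Rep} {Φ : Config → Prop}

theorem of_step {c c' : Config} (h : Good F l Φ c) (hs : Step F l c c') : Good F l Φ c' := by
  cases h with
  | halt _ h _ => exact absurd h hs.todo_ne_nil
  | step _ _ hc => exact hc _ hs

theorem of_reflTransGen {c c' : Config} (h : Good F l Φ c)
    (hs : Relation.ReflTransGen (Step F l) c c') : Good F l Φ c' := by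
  induction hs with
  | refl => exact h
  | tail _ hs ih => exact ih.of_step hs

theorem not_infinite {c : Config} (h : Good F l Φ c) :
    ¬ ∃ f : ℕ → Config, f 0 = c ∧ ∀ i, Step F l (f i) (f (i + 1)) := by
  induction h with
  | halt c h _ =>
    rintro ⟨f, rfl, hf⟩
    exact (hf 0).todo_ne_nil h
  | step c _ _ ih =>
    rintro ⟨f, rfl, hf⟩
    exact ih (f 1) (hf 0) ⟨fun i => f (i + 1), rfl, fun i => hf (i + 1)⟩

/-- Time never decreases along a run, so a bound on final configurations bounds all earlier ones. -/
theorem time_le {B : ℕ} (hΦ : ∀ c, Φ c → c.time ≤ B) {c : Config} (h : Good F l Φ c) :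
    c.time ≤ B := by
  induction h with
  | halt c _ hc => exact hΦ c hc
  | step c h _ ih =>
    obtain ⟨c', hc'⟩ := h
    exact hc'.time_le.trans (ih c' hc')

theorem of_stuck {c : Config} (h : Good F l Φ c) (hs : ¬ ∃ c', Step F l c c') :
    c.todo = [] ∧ Φ c := by
  cases h with
  | halt _ h hc => exact ⟨h, hc⟩
  | step _ h _ => exact absurd h hs

end Good

/-- From the registers `s`, the program `P` takes at most `b` units of time and ends with
registers satisfying `Q`. -/
def Triple (F : LearningFramework) (l : F.Rep) (s : ℕ → Data) (P : Program) (b : ℕ)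
    (Q : (ℕ → Data) → Prop) : Prop :=
  ∀ (Φ : Config → Prop) (k : List Program) (t m : ℕ),
    (∀ s' t' m', t' ≤ t + b → Q s' → Good F l Φ ⟨k, s', t', m'⟩) → Good F l Φ ⟨P :: k, s, t, m⟩

namespace Triple

variable {F : LearningFramework} {l : F.Rep} {s : ℕ → Data} {P P' : Program} {b b' : ℕ}
  {Q Q' : (ℕ → Data) → Prop} {x y z : ℕ}

theorem mono (h : Triple F l s P b Q) (hb : b ≤ b') (hQ : ∀ s', Q s' → Q' s') :
    Triple F l s P b' Q' := fun Φ k t m hk =>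
  h Φ k t m fun s' t' m' ht hq => hk s' t' m' (by omega) (hQ s' hq)

theorem setNil (h : Q (Function.update s x .nil)) : Triple F l s (.setNil x) 1 Q := by
  intro Φ k t m hk
  refine .step _ ⟨_, .setNil x k s t m⟩ fun c' hc => ?_
  cases hc
  exact hk _ _ _ le_rfl h

theorem copy (h : Q (Function.update s x (s y))) : Triple F l s (.copy x y) 1 Q := by
  intro Φ k t m hk
  refine .step _ ⟨_, .copy x y k s t m⟩ fun c' hc => ?_
  cases hc
  exact hk _ _ _ le_rfl h

theorem setCons (h : Q (Function.update s x (.cons (s y) (s z)))) :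
    Triple F l s (.setCons x y z) 1 Q := by
  intro Φ k t m hk
  refine .step _ ⟨_, .setCons x y z k s t m⟩ fun c' hc => ?_
  cases hc
  exact hk _ _ _ le_rfl h

theorem setHead (h : Q (Function.update s x (s y).head)) : Triple F l s (.setHead x y) 1 Q := by
  intro Φ k t m hk
  refine .step _ ⟨_, .setHead x y k s t m⟩ fun c' hc => ?_
  cases hc
  exact hk _ _ _ le_rfl h

theorem setTail (h : Q (Function.update s x (s y).tail)) : Triple F l s (.setTail x y) 1 Q := by
  intro Φ k t m hk
  refine .step _ ⟨_, .setTail x y k s t m⟩ fun c' hc => ?_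
  cases hc
  exact hk _ _ _ le_rfl h

/-- The continuation form of `Triple` does the work: `P'` followed by the remaining stack serves as
continuation of `P`. The extra unit pays for unfolding the `seq` instruction. -/
theorem seq (h : Triple F l s P b Q') (h' : ∀ s', Q' s' → Triple F l s' P' b' Q) :
    Triple F l s (.seq P P') (b + b' + 1) Q := by
  intro Φ k t m hk
  refine .step _ ⟨_, .seq P P' k s t m⟩ fun c' hc => ?_
  cases hc
  exact h _ _ _ _ fun s' t' m' ht hq => h' s' hq _ _ _ _ fun s'' t'' m'' ht' hq' =>
    hk _ _ _ (by omega) hq'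

theorem ifte (h : s x ≠ .nil → Triple F l s P b Q) (h' : s x = .nil → Triple F l s P' b Q) :
    Triple F l s (.ifte x P P') (b + 1) Q := by
  intro Φ k t m hk
  by_cases hx : s x = .nil
  · refine .step _ ⟨_, .ifFalse x P P' k s t m hx⟩ fun c' hc => ?_
    cases hc with
    | ifTrue _ _ _ _ _ _ _ hx' => exact absurd hx hx'
    | ifFalse => exact h' hx _ _ _ _ fun s' t' m' ht hq => hk _ _ _ (by omega) hq
  · refine .step _ ⟨_, .ifTrue x P P' k s t m hx⟩ fun c' hc => ?_
    cases hc with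
    | ifFalse _ _ _ _ _ _ _ hx' => exact absurd hx' hx
    | ifTrue => exact h hx _ _ _ _ fun s' t' m' ht hq => hk _ _ _ (by omega) hq

/-- The index `j` is a variant bounding the number of remaining passes. A pass costs `b` plus one
unit for the test; the final unit is the failing test. -/
theorem loop {I : ℕ → (ℕ → Data) → Prop}
    (h : ∀ j s, I j s → s x ≠ .nil → 0 < j ∧ Triple F l s P b (fun s' => ∃ i < j, I i s')) :
    ∀ (j : ℕ) (s : ℕ → Data), I j s →
      Triple F l s (.loop x P) (j * (b + 1) + 1) (fun s' => s' x = .nil ∧ ∃ i, I i s') := by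
  intro j
  induction j using Nat.strong_induction_on with
  | _ j ih =>
    intro s hs Φ k t m hk
    by_cases hx : s x = .nil
    · refine .step _ ⟨_, .loopFalse x P k s t m hx⟩ fun c' hc => ?_
      cases hc with
      | loopTrue _ _ _ _ _ _ hx' => exact absurd hx hx'
      | loopFalse => exact hk _ _ _ (by omega) ⟨hx, j, hs⟩
    · refine .step _ ⟨_, .loopTrue x P k s t m hx⟩ fun c' hc => ?_
      cases hc with
      | loopFalse _ _ _ _ _ _ hx' => exact absurd hx' hx
      | loopTrue =>
        refine (h j s hs hx).2 _ _ _ _ fun s' t' m' ht hq => ?_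
        obtain ⟨i, hij, hi⟩ := hq
        refine ih i hij s' hi _ _ _ _ fun s'' t'' m'' ht' hq' => hk _ _ _ ?_ hq'
        have : (i + 1) * (b + 1) ≤ j * (b + 1) := Nat.mul_le_mul_right _ hij
        rw [Nat.add_mul] at this
        omega

open Classical in
theorem askMem {e : F.Example} (he : s y = F.encodeExample e)
    (h : Q (Function.update s x (Data.ofBool (decide (e ∈ F.concept l))))) :
    Triple F l s (.askMem x y) (1 + (s y).size) Q := by
  intro Φ k t m hk
  refine .step _ ⟨_, .askMem x y k s t m e he⟩ fun c' hc => ?_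
  cases hc with
  | askMem _ _ _ _ _ _ e' he' =>
    -- Encodings are lossless, so the register determines the query.
    obtain rfl := F.encodeExample_injective (he.symm.trans he')
    exact hk _ _ _ (by omega) h

theorem askEq {r : F.Rep} (hr : s y = F.encodeRep r)
    (hyes : F.concept r = F.concept l → Q (Function.update s x .nil))
    (hno : ∀ e ∈ symmDiff (F.concept r) (F.concept l),
      Q (Function.update s x (.cons (F.encodeExample e) .nil))) :
    Triple F l s (.askEq x y) (1 + (s y).size) Q := by
  intro Φ k t m hk
  refine .step _ ?_ fun c' hc => ?_
  -- The machine is never stuck here: if the concepts differ, a counterexample exists.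
  · by_cases heq : F.concept r = F.concept l
    · exact ⟨_, .askEqYes x y k s t m r hr heq⟩
    · obtain ⟨e, he⟩ := Set.symmDiff_nonempty.mpr heq
      exact ⟨_, .askEqNo x y k s t m r hr e he⟩
  · cases hc with
    | askEqYes _ _ _ _ _ _ r' hr' heq =>
      obtain rfl := F.encodeRep_injective (hr.symm.trans hr')
      exact hk _ _ _ (by omega) (hyes heq)
    | askEqNo _ _ _ _ _ _ r' hr' e he =>
      obtain rfl := F.encodeRep_injective (hr.symm.trans hr')
      exact hk _ _ _ (by omega) (hno e he)

end Triple

/-! ### Expressions -/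

/-- An expression, as a program depending on the register `b` where its arguments begin and on the
register `d` that receives its value; it leaves the registers below `d` unchanged. -/
abbrev Code : Type := ℕ → ℕ → Program

namespace Code

def var (i : ℕ) : Code := fun b d => .copy d (b + i)
def nil : Code := fun _ d => .setNil d
def head (a : Code) : Code := fun b d => .seq (a b d) (.setHead d d)
def tail (a : Code) : Code := fun b d => .seq (a b d) (.setTail d d)
def cons (a c : Code) : Code := fun b d =>
  .seq (a b d) (.seq (c b (d + 1)) (.setCons d d (d + 1)))
def ite (a c e : Code) : Code := fun b d => .seq (a b d) (.ifte d (c b d) (e b d))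
def mem (a : Code) : Code := fun b d => .seq (a b d) (.askMem d d)
/-- The value of `f` with that of `a` as an additional last argument. -/
def bind (a f : Code) : Code := fun b d =>
  .seq (a b d) (.seq (f b (d + 1)) (.copy d (d + 1)))
/-- The value of `f` on the last `k` arguments. -/
def onLast (k : ℕ) (f : Code) : Code := fun _ d => f (d - k) d
def call1 (f a : Code) : Code := bind a (onLast 1 f)
def call2 (f a c : Code) : Code := bind a (bind c (onLast 2 f))
def call3 (f a c e : Code) : Code := bind a (bind c (bind e (onLast 3 f)))
/-- Left fold of `f` over the list `a` with initial value `c`. The additional arguments of `f` are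
the remaining list, the accumulator and the current element. -/
def fold (a c f : Code) : Code := fun b d =>
  .seq (a b d) (.seq (c b (d + 1)) (.seq
    (.loop d (.seq (.setHead (d + 2) d) (.seq (.setTail d d)
      (.seq (f b (d + 3)) (.copy (d + 1) (d + 3))))))
    (.copy d (d + 1))))

end Code

/-- The registers from `b` on hold the values `env`. -/
def Holds (s : ℕ → Data) (b : ℕ) (env : List Data) : Prop :=
  ∀ i (h : i < env.length), s (b + i) = env[i]

theorem Holds.congr {s s' : ℕ → Data} {b : ℕ} {env : List Data} (h : Holds s b env)
    (hs : ∀ i < b + env.length, s' i = s i) : Holds s' b env := fun i hi => by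
  rw [hs _ (by omega), h i hi]

/-- A value is delivered to the first register after the arguments, so it becomes an additional last
argument without being moved. -/
theorem Holds.append {s : ℕ → Data} {b : ℕ} {env : List Data} {v : Data} (h : Holds s b env)
    (hs : s (b + env.length) = v) : Holds s b (env ++ [v]) := fun i hi => by
  rcases Nat.lt_or_ge i env.length with h' | h'
  · rw [h i h', List.getElem_append_left]
  · obtain rfl : i = env.length := by simp at hi; omega
    simpa using hs

/-- The expression `a` has value `v` on the arguments `env`, computed in time at most `c`. -/
def Ev (F : LearningFramework) (l : F.Rep) (a : Code) (env : List Data) (v : Data) (c : ℕ) :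
    Prop :=
  ∀ (b : ℕ) (s : ℕ → Data), Holds s b env →
    Triple F l s (a b (b + env.length)) c
      (fun s' => s' (b + env.length) = v ∧ ∀ i < b + env.length, s' i = s i)

namespace Ev

variable {F : LearningFramework} {l : F.Rep} {a a₁ a₂ a₃ f : Code} {env : List Data}
  {v v₁ v₂ v₃ w : Data} {c c' c₁ c₂ c₃ : ℕ}

theorem conv (h : Ev F l a env v c) (hv : v = w) (hc : c ≤ c') : Ev F l a env w c' := by
  subst hv
  exact fun b s hs => (h b s hs).mono hc fun _ => id

theorem var {i : ℕ} (h : env[i]? = some v) : Ev F l (.var i) env v 1 := by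
  intro b s hs
  obtain ⟨hi, rfl⟩ := List.getElem?_eq_some_iff.mp h
  refine Triple.copy ⟨by simp [hs i hi], fun j hj => ?_⟩
  rw [Function.update_of_ne hj.ne]

theorem nil : Ev F l .nil env .nil 1 := fun b s _ =>
  Triple.setNil ⟨by simp, fun j hj => by rw [Function.update_of_ne hj.ne]⟩

theorem head (h : Ev F l a env v c) : Ev F l (.head a) env v.head (c + 2) := fun b s hs =>
  ((h b s hs).seq fun s' hs' => Triple.setHead ⟨by simp [hs'.1], fun j hj => by
    rw [Function.update_of_ne hj.ne, hs'.2 j hj]⟩)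

theorem tail (h : Ev F l a env v c) : Ev F l (.tail a) env v.tail (c + 2) := fun b s hs =>
  ((h b s hs).seq fun s' hs' => Triple.setTail ⟨by simp [hs'.1], fun j hj => by
    rw [Function.update_of_ne hj.ne, hs'.2 j hj]⟩)

theorem cons (h₁ : Ev F l a₁ env v₁ c₁) (h₂ : Ev F l a₂ (env ++ [v₁]) v₂ c₂) :
    Ev F l (.cons a₁ a₂) env (.cons v₁ v₂) (c₁ + c₂ + 3) := fun b s hs => by
  refine ((h₁ b s hs).seq fun s' hs' => ?_).mono (b := c₁ + (c₂ + 1 + 1) + 1) (by omega)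
    fun _ => id
  have := h₂ b s' ((hs.congr hs'.2).append hs'.1)
  simp only [List.length_append, List.length_singleton, ← Nat.add_assoc] at this
  refine this.seq fun s'' hs'' => Triple.setCons ⟨?_, fun j hj => ?_⟩
  · simp [hs''.1, hs''.2 _ (Nat.lt_succ_self _), hs'.1]
  · rw [Function.update_of_ne hj.ne, hs''.2 j (by omega), hs'.2 j hj]

theorem ite (h₁ : Ev F l a₁ env v₁ c₁) (h₂ : v₁ ≠ .nil → Ev F l a₂ env v c)
    (h₃ : v₁ = .nil → Ev F l a₃ env v c) : Ev F l (.ite a₁ a₂ a₃) env v (c₁ + c + 2) := by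
  intro b s hs
  refine (h₁ b s hs).seq fun s' hs' => Triple.ifte (b := c) (fun hx => ?_) fun hx => ?_
  · exact (h₂ (hs'.1 ▸ hx) b s' (hs.congr hs'.2)).mono le_rfl fun s'' hs'' =>
      ⟨hs''.1, fun j hj => by rw [hs''.2 j hj, hs'.2 j hj]⟩
  · exact (h₃ (hs'.1 ▸ hx) b s' (hs.congr hs'.2)).mono le_rfl fun s'' hs'' =>
      ⟨hs''.1, fun j hj => by rw [hs''.2 j hj, hs'.2 j hj]⟩

theorem ite_bool {p : Prop} [Decidable p] (h₁ : Ev F l a₁ env (.ofBool (decide p)) c₁)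
    (h₂ : p → Ev F l a₂ env v c) (h₃ : ¬ p → Ev F l a₃ env v c) :
    Ev F l (.ite a₁ a₂ a₃) env v (c₁ + c + 2) := by
  by_cases hp : p
  · exact h₁.ite (fun _ => h₂ hp) fun h => by simp [hp, Data.ofBool] at h
  · exact h₁.ite (fun h => by simp [hp, Data.ofBool] at h) fun _ => h₃ hp

open Classical in
theorem mem {e : F.Example} (h : Ev F l a env (F.encodeExample e) c) :
    Ev F l (.mem a) env (.ofBool (decide (e ∈ F.concept l)))
      (c + (F.encodeExample e).size + 2) := fun b s hs => by
  refine ((h b s hs).seq fun s' hs' => ?_).mono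
    (b := c + (1 + (F.encodeExample e).size) + 1) (by omega) fun _ => id
  rw [← hs'.1]
  exact Triple.askMem hs'.1 ⟨by simp, fun j hj => by
    rw [Function.update_of_ne hj.ne, hs'.2 j hj]⟩

theorem bind (h₁ : Ev F l a env v₁ c₁) (h₂ : Ev F l f (env ++ [v₁]) v c₂) :
    Ev F l (.bind a f) env v (c₁ + c₂ + 3) := fun b s hs => by
  refine ((h₁ b s hs).seq fun s' hs' => ?_).mono (b := c₁ + (c₂ + 1 + 1) + 1) (by omega)
    fun _ => id
  have := h₂ b s' ((hs.congr hs'.2).append hs'.1)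
  simp only [List.length_append, List.length_singleton, ← Nat.add_assoc] at this
  refine this.seq fun s'' hs'' => Triple.copy ⟨by simp [hs''.1], fun j hj => ?_⟩
  rw [Function.update_of_ne hj.ne, hs''.2 j (by omega), hs'.2 j hj]

theorem onLast {args : List Data} (h : Ev F l f args v c) :
    Ev F l (.onLast args.length f) (env ++ args) v c := fun b s hs => by
  have := h (b + env.length) s fun i hi => by
    have := hs (env.length + i) (by simp [hi])
    rw [← Nat.add_assoc] at this
    simpa using this
  rw [Code.onLast, List.length_append, ← Nat.add_assoc, Nat.add_sub_cancel]
  exact this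

theorem call1 (hf : Ev F l f [v₁] v c) (h₁ : Ev F l a₁ env v₁ c₁) :
    Ev F l (.call1 f a₁) env v (c₁ + c + 3) :=
  h₁.bind hf.onLast

theorem call2 (hf : Ev F l f [v₁, v₂] v c) (h₁ : Ev F l a₁ env v₁ c₁)
    (h₂ : Ev F l a₂ (env ++ [v₁]) v₂ c₂) :
    Ev F l (.call2 f a₁ a₂) env v (c₁ + c₂ + c + 6) :=
  (h₁.bind (h₂.bind (by simpa using hf.onLast (env := env)))).conv rfl (by omega)

theorem call3 (hf : Ev F l f [v₁, v₂, v₃] v c) (h₁ : Ev F l a₁ env v₁ c₁)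
    (h₂ : Ev F l a₂ (env ++ [v₁]) v₂ c₂) (h₃ : Ev F l a₃ (env ++ [v₁] ++ [v₂]) v₃ c₃) :
    Ev F l (.call3 f a₁ a₂ a₃) env v (c₁ + c₂ + c₃ + c + 9) :=
  (h₁.bind (h₂.bind (h₃.bind (by simpa using hf.onLast (env := env))))).conv rfl (by omega)

/-- Registers `d`, `d + 1`, `d + 2` hold the remaining list, the accumulator and the current
element; the body writes to `d + 3`. The invariant is that folding the remaining list from the
accumulator gives the final value. The 7 counts the three moves, three `seq` units and the test of a
pass. -/
theorem fold {α β : Type} {enc : α → Data} {enc' : β → Data} {L : List α} {g : β → α → β} {z : β}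
    (h₁ : Ev F l a₁ env (.ofList (L.map enc)) c₁)
    (h₂ : Ev F l a₂ (env ++ [.ofList (L.map enc)]) (enc' z) c₂)
    (hf : ∀ r y, ∀ x ∈ L, Ev F l f (env ++ [r, enc' y, enc x]) (enc' (g y x)) c) :
    Ev F l (.fold a₁ a₂ f) env (enc' (L.foldl g z)) (c₁ + c₂ + L.length * (c + 7) + 5) := by
  intro b s hs
  refine ((h₁ b s hs).seq fun s₁ hs₁ => ?_).mono
    (b := c₁ + (c₂ + ((L.length * (1 + (1 + (c + 1 + 1) + 1) + 1 + 1) + 1) + 1 + 1) + 1) + 1)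
    (by have : 1 + (1 + (c + 1 + 1) + 1) + 1 + 1 = c + 7 := by omega
        rw [this]; omega) fun _ => id
  have := h₂ b s₁ ((hs.congr hs₁.2).append hs₁.1)
  simp only [List.length_append, List.length_singleton, ← Nat.add_assoc] at this
  refine this.seq fun s₂ hs₂ => ?_
  clear this
  set d := b + env.length with hd
  have hl : s₂ d = .ofList (L.map enc) := by rw [hs₂.2 d (by omega), hs₁.1]
  have hs₂' : ∀ i < d, s₂ i = s i := fun i hi => by rw [hs₂.2 i (by omega), hs₁.2 i hi]
  refine Triple.seq (b := L.length * (1 + (1 + (c + 1 + 1) + 1) + 1 + 1) + 1) (b' := 1)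
    (Triple.loop (I := fun j s' => ∃ M : List α, ∃ y : β, M.length = j ∧
      (∀ x ∈ M, x ∈ L) ∧ M.foldl g y = L.foldl g z ∧
      s' d = .ofList (M.map enc) ∧ s' (d + 1) = enc' y ∧ ∀ i < d, s' i = s i) ?_ L.length s₂
      ⟨L, z, rfl, fun _ => id, rfl, hl, hs₂.1, hs₂'⟩) ?_
  · rintro j s' ⟨M, y, rfl, hM, hfold, hsd, hsy, hsi⟩ hne
    cases M with
    | nil => simp [hsd, Data.ofList] at hne
    | cons x M =>
      refine ⟨by simp, ?_⟩
      refine Triple.seq (Triple.setHead (Q := fun s'' =>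
        s'' = Function.update s' (d + 2) (s' d).head) rfl) ?_
      rintro _ rfl
      refine Triple.seq (Triple.setTail (Q := fun s'' => s'' d = .ofList (M.map enc) ∧
        s'' (d + 1) = enc' y ∧ s'' (d + 2) = enc x ∧ ∀ i < d, s'' i = s i) ?_) ?_
      · refine ⟨?_, ?_, ?_, fun i hi => ?_⟩
        · simp [hsd, Data.ofList, Data.tail]
        · simp [hsy]
        · simp [hsd, Data.ofList, Data.head]
        · rw [Function.update_of_ne (by omega), Function.update_of_ne (by omega), hsi i hi]
      · rintro s'' ⟨h0, h1, h2, h3⟩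
        have hh : Holds s'' b (env ++ [.ofList (M.map enc)] ++ [enc' y] ++ [enc x]) := by
          refine (((hs.congr h3).append h0).append ?_).append ?_
          · simpa [← Nat.add_assoc] using h1
          · simpa [← Nat.add_assoc] using h2
        have := hf (.ofList (M.map enc)) y x (hM x (by simp)) b s'' (by simpa using hh)
        simp only [List.length_append, List.length_cons, List.length_nil, ← Nat.add_assoc,
          ← hd] at this
        refine this.seq fun s₃ hs₃ => Triple.copy ⟨M.length, by simp, M, g y x, rfl,
          fun z hz => hM z (by simp [hz]), by simpa using hfold, ?_, ?_, fun i hi => ?_⟩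
        · rw [Function.update_of_ne (by omega), hs₃.2 _ (by omega), h0]
        · simpa using hs₃.1
        · rw [Function.update_of_ne (by omega), hs₃.2 _ (by omega), h3 i hi]
  · rintro s' ⟨hnil, j, M, y, rfl, hM, hfold, hsd, hsy, hsi⟩
    obtain rfl : M = [] := by
      cases M with
      | nil => rfl
      | cons => simp [hsd, Data.ofList] at hnil
    refine Triple.copy ⟨?_, fun i hi => ?_⟩
    · rw [Function.update_self, hsy, ← hfold, List.foldl_nil]
    · rw [Function.update_of_ne hi.ne, hsi i hi]

end Ev
end HornLearning

namespace HornLearning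

/-! ### Antecedent sets and the target sentence -/

section Horn

variable {n : ℕ}

/-- The set of variables `X`, as an interpretation, falsifies the clause `c`. -/
def Violates (c : HornClause n) (X : Finset (Fin n)) : Prop :=
  c.ant ⊆ X ∧ ∀ v, c.head = some v → v ∉ X

/-- The set `X`, as an interpretation, falsifies the sentence `T`. -/
def IsNegative (T : HornSentence n) (X : Finset (Fin n)) : Prop := ∃ c ∈ T, Violates c X

theorem sat_mem_iff_not_violates (c : HornClause n) (X : Finset (Fin n)) :
    HornClause.Sat (fun v => decide (v ∈ X)) c ↔ ¬ Violates c X := by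
  simp only [HornClause.Sat, Violates, decide_eq_false_iff_not, decide_eq_true_eq, not_and_or,
    Finset.not_subset, not_forall, not_not]
  simp

/-- If `X` falsifies a clause of `T`, enlarging its antecedent to `X` keeps it entailed. Conversely,
`X` itself falsifies the clause on the right, so it is not a model of `T`. -/
theorem isNegative_iff_exists_entails {T : HornSentence n} {X : Finset (Fin n)} :
    IsNegative T X ↔ ∃ h : Option (Fin n), T.Entails ⟨X, h⟩ ∧ ∀ v, h = some v → v ∉ X := by
  constructor
  · rintro ⟨c, hc, hcX⟩
    refine ⟨c.head, fun I hI => ?_, hcX.2⟩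
    rcases hI c hc with ⟨v, hv, hIv⟩ | h
    · exact .inl ⟨v, hcX.1 hv, hIv⟩
    · exact .inr h
  · rintro ⟨h, hT, hX⟩
    by_contra hneg
    have := hT (fun v => decide (v ∈ X)) fun c hc =>
      (sat_mem_iff_not_violates c X).mpr fun hcX => hneg ⟨c, hc, hcX⟩
    exact (sat_mem_iff_not_violates _ X).mp this ⟨subset_rfl, hX⟩

theorem entails_of_ant_subset {T : HornSentence n} {c : HornClause n} (hc : c ∈ T)
    {X : Finset (Fin n)} (h : c.ant ⊆ X) : T.Entails ⟨X, c.head⟩ := by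
  intro I hI
  rcases hI c hc with ⟨v, hv, hIv⟩ | h'
  · exact .inl ⟨v, h hv, hIv⟩
  · exact .inr h'

theorem HornSentence.card_le_length (T : HornSentence n) : List.length T ≤ T.length := by
  have : (T.map HornClause.length).length • 1 ≤ (T.map HornClause.length).sum :=
    List.card_nsmul_le_sum _ _ fun k hk => by
      obtain ⟨c, -, rfl⟩ := List.mem_map.mp hk
      simp [HornClause.length]
  simp only [List.length_map, smul_eq_mul, mul_one] at this
  simp only [HornSentence.length]
  omega

/-! ### Admissible lists and their refinement -/

/-- The invariant of the list of antecedent sets. -/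
structure Admissible (T : HornSentence n) (Xs : List (Finset (Fin n))) : Prop where
  isNegative : ∀ X ∈ Xs, IsNegative T X
  pairwise : Xs.Pairwise fun A B => ∀ c ∈ T, Violates c B → ¬ c.ant ⊆ A

/-- Choose for each member a clause of `T` that it falsifies. If `A` precedes `B` and both get the
same clause, its antecedent lies in `A` although `B` falsifies it, against the invariant; so the
choice is injective. -/
theorem Admissible.length_le {T : HornSentence n} {Xs : List (Finset (Fin n))}
    (h : Admissible T Xs) : Xs.length ≤ T.length := by
  classical
  by_cases hT : T = []
  · cases Xs with
    | nil => simp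
    | cons X Xs => obtain ⟨c, hc, -⟩ := h.isNegative X (by simp); simp [hT] at hc
  obtain ⟨c₀, hc₀⟩ := List.exists_mem_of_ne_nil T hT
  have : ∀ X, ∃ c, X ∈ Xs → c ∈ T ∧ Violates c X := fun X => by
    by_cases hX : X ∈ Xs
    · obtain ⟨c, hc⟩ := h.isNegative X hX
      exact ⟨c, fun _ => hc⟩
    · exact ⟨c₀, fun h => absurd h hX⟩
  choose f hf using this
  have hnd : (Xs.map f).Nodup := by
    refine List.pairwise_map.mpr (h.pairwise.imp_of_mem fun {A B} hA hB hAB heq => ?_)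
    exact hAB (f B) (hf B hB).1 (hf B hB).2 (heq ▸ (hf A hA).2.1)
  have hsub : Xs.map f ⊆ T := fun c hc => by
    obtain ⟨X, hX, rfl⟩ := List.mem_map.mp hc
    exact (hf X hX).1
  have hlen : Xs.length ≤ List.length T := by simpa using (hnd.subperm hsub).length_le
  exact hlen.trans T.card_le_length

open Classical in
/-- Intersect the first suitable set of the list with `x`, or else append `x`. -/
noncomputable def refine (T : HornSentence n) (x : Finset (Fin n)) :
    List (Finset (Fin n)) → List (Finset (Fin n))
  | [] => [x]
  | X :: Xs => if ¬ X ⊆ x ∧ IsNegative T (X ∩ x) then (X ∩ x) :: Xs else X :: refine T x Xs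

/-- The set `x` contains everything that `T` entails from the sets of the list contained in it. -/
def Saturated (T : HornSentence n) (Xs : List (Finset (Fin n))) (x : Finset (Fin n)) : Prop :=
  ∀ X ∈ Xs, X ⊆ x → ∀ h, T.Entails ⟨X, h⟩ → ∃ v ∈ x, h = some v

/-- Models of a Horn clause are closed under intersection because there is at most one head: if both
sets contain the antecedent and satisfy the clause, both contain that same head. -/
theorem Violates.of_inter {c : HornClause n} {X x : Finset (Fin n)} (h : Violates c (X ∩ x)) :
    Violates c X ∨ Violates c x := by
  by_contra! hcon
  obtain ⟨h1, h2⟩ := hcon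
  simp only [Violates, not_and, not_forall, not_not] at h1 h2
  obtain ⟨v, hv, hvX⟩ := h1 (h.1.trans Finset.inter_subset_left)
  obtain ⟨w, hw, hwx⟩ := h2 (h.1.trans Finset.inter_subset_right)
  obtain rfl : v = w := Option.some_injective _ (hv.symm.trans hw)
  exact h.2 v hv (Finset.mem_inter.mpr ⟨hvX, hwx⟩)

theorem violates_of_mem_refine {T : HornSentence n} {x B : Finset (Fin n)}
    {Xs : List (Finset (Fin n))} (hB : B ∈ refine T x Xs) {c : HornClause n}
    (hc : Violates c B) : Violates c x ∨ ∃ A ∈ Xs, Violates c A := by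
  induction Xs with
  | nil => simp only [refine, List.mem_singleton] at hB; exact .inl (hB ▸ hc)
  | cons X Xs ih =>
    rw [refine] at hB
    split_ifs at hB with h
    · rcases List.mem_cons.mp hB with rfl | hB
      · rcases hc.of_inter with h' | h'
        · exact .inr ⟨X, by simp, h'⟩
        · exact .inl h'
      · exact .inr ⟨B, by simp [hB], hc⟩
    · rcases List.mem_cons.mp hB with rfl | hB
      · exact .inr ⟨B, by simp, hc⟩
      · rcases ih hB with h' | ⟨A, hA, h'⟩
        · exact .inl h'
        · exact .inr ⟨A, by simp [hA], h'⟩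

/-- The critical case is a set `X` passed over, with a clause of `T` that has its antecedent in `X`
and is falsified by a later member. That clause is falsified by an old later member, which the old
invariant excludes, or by `x`. In the latter case `X ⊆ x` contradicts saturation, and `X ⊄ x` would
make `X ∩ x` negative, so `X` would have been replaced. -/
theorem Admissible.refine {T : HornSentence n} {x : Finset (Fin n)}
    {Xs : List (Finset (Fin n))} (h : Admissible T Xs) (hx : IsNegative T x)
    (hs : Saturated T Xs x) : Admissible T (refine T x Xs) := by
  induction Xs with
  | nil => exact ⟨by simpa [HornLearning.refine] using hx, by simp [HornLearning.refine]⟩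
  | cons X Xs ih =>
    obtain ⟨h1, h2⟩ := h
    rw [List.pairwise_cons] at h2
    have ih := ih ⟨fun Y hY => h1 Y (by simp [hY]), h2.2⟩ fun Y hY => hs Y (by simp [hY])
    rw [HornLearning.refine]
    split_ifs with hX
    · refine ⟨fun Y hY => ?_, List.pairwise_cons.mpr ⟨fun B hB c hc hcB hsub => ?_, h2.2⟩⟩
      · rcases List.mem_cons.mp hY with rfl | hY
        · exact hX.2
        · exact h1 Y (by simp [hY])
      · exact h2.1 B hB c hc hcB (hsub.trans Finset.inter_subset_left)
    · refine ⟨fun Y hY => ?_, List.pairwise_cons.mpr ⟨fun B hB c hc hcB hsub => ?_, ih.pairwise⟩⟩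
      · rcases List.mem_cons.mp hY with rfl | hY
        · exact h1 Y (by simp)
        · exact ih.isNegative Y hY
      · rcases violates_of_mem_refine hB hcB with hcx | ⟨A, hA, hcA⟩
        · by_cases hXx : X ⊆ x
          · obtain ⟨v, hv, hcv⟩ := hs X (by simp) hXx c.head (entails_of_ant_subset hc hsub)
            exact hcx.2 v hcv hv
          · refine hX ⟨hXx, c, hc, Finset.subset_inter hsub hcx.1, fun v hv hvX => ?_⟩
            exact hcx.2 v hv (Finset.mem_inter.mp hvX).2
        · exact h2.1 A hA c hc hcA hsub

/-- The measure of progress. -/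
def progress (Xs : List (Finset (Fin n))) : ℕ := (Xs.map fun X => n + 1 - X.card).sum

theorem progress_le (Xs : List (Finset (Fin n))) : progress Xs ≤ Xs.length * (n + 1) := by
  have := List.sum_le_card_nsmul (Xs.map fun X => n + 1 - X.card) (n + 1) (by simp)
  simpa [progress] using this

/-- The summand `n + 1 - |X|` is positive even for the full set, so appending counts as progress
too. -/
theorem progress_lt_refine (T : HornSentence n) (x : Finset (Fin n))
    (Xs : List (Finset (Fin n))) : progress Xs < progress (refine T x Xs) := by
  have hcard : ∀ X : Finset (Fin n), X.card ≤ n := fun X => by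
    simpa using Finset.card_le_univ X
  induction Xs with
  | nil => have := hcard x; simp [progress, refine]; omega
  | cons X Xs ih =>
    rw [refine]
    split_ifs with hX
    · have h1 : (X ∩ x).card < X.card := Finset.card_lt_card
        ⟨Finset.inter_subset_left, fun h => hX.1 (h.trans Finset.inter_subset_right)⟩
      have := hcard X
      simp only [progress, List.map_cons, List.sum_cons]
      omega
    · simp only [progress, List.map_cons, List.sum_cons] at ih ⊢
      omega

/-! ### Forward chaining -/

/-- The variables that `T` entails from `X`. -/
noncomputable def entailedVars (T : HornSentence n) (X : Finset (Fin n)) : Finset (Fin n) := by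
  classical exact Finset.univ.filter fun v => T.Entails ⟨X, some v⟩

theorem mem_entailedVars {T : HornSentence n} {X : Finset (Fin n)} {v : Fin n} :
    v ∈ entailedVars T X ↔ T.Entails ⟨X, some v⟩ := by
  simp [entailedVars]

/-- Add to `x` what `T` entails from `X`, provided that `x` contains `X`. -/
noncomputable def absorb (T : HornSentence n) (x X : Finset (Fin n)) : Finset (Fin n) :=
  if X ⊆ x then x ∪ entailedVars T X else x

theorem subset_absorb (T : HornSentence n) (x X : Finset (Fin n)) : x ⊆ absorb T x X := by
  rw [absorb]; split_ifs <;> simp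

theorem subset_foldl_absorb (T : HornSentence n) (Xs : List (Finset (Fin n)))
    (x : Finset (Fin n)) : x ⊆ Xs.foldl (absorb T) x := by
  induction Xs generalizing x with
  | nil => simp
  | cons X Xs ih => exact (subset_absorb T x X).trans (ih _)

theorem absorb_eq_of_foldl_eq {T : HornSentence n} {Xs : List (Finset (Fin n))}
    {x : Finset (Fin n)} (h : Xs.foldl (absorb T) x = x) : ∀ X ∈ Xs, absorb T x X = x := by
  induction Xs with
  | nil => simp
  | cons X Xs ih =>
    have h1 : absorb T x X = x := by
      refine Finset.Subset.antisymm ?_ (subset_absorb T x X)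
      conv_rhs => rw [← h]
      exact subset_foldl_absorb T Xs _
    rw [List.foldl_cons, h1] at h
    intro Y hY
    rcases List.mem_cons.mp hY with rfl | hY
    · exact h1
    · exact ih h Y hY

/-- Every round that is not yet stationary adds an element, and there are only `n` of them. -/
theorem iterate_fixed_of_subset {f : Finset (Fin n) → Finset (Fin n)} (hf : ∀ x, x ⊆ f x)
    (x : Finset (Fin n)) : f (f^[n] x) = f^[n] x := by
  have key : ∀ k, k ≤ (f^[k] x).card ∨ f (f^[k] x) = f^[k] x := by
    intro k
    induction k with
    | zero => simp
    | succ k ih =>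
      rw [Function.iterate_succ_apply']
      by_cases h : f (f^[k] x) = f^[k] x
      · exact .inr (by rw [h, h])
      · have h1 : (f^[k] x).card < (f (f^[k] x)).card :=
          Finset.card_lt_card ((hf _).ssubset_of_ne (Ne.symm h))
        rcases ih with ih | ih
        · exact .inl (by omega)
        · exact absurd ih h
  rcases key n with h | h
  · have : f^[n] x = Finset.univ := by
      rw [← Finset.card_eq_iff_eq_univ, Fintype.card_fin]
      exact le_antisymm (by simpa using Finset.card_le_univ (f^[n] x)) h
    rw [this]
    exact Finset.Subset.antisymm (Finset.subset_univ _) (hf _)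
  · exact h

/-- Forward chaining from `x`. -/
noncomputable def saturate (T : HornSentence n) (Xs : List (Finset (Fin n)))
    (x : Finset (Fin n)) : Finset (Fin n) :=
  (fun y => Xs.foldl (absorb T) y)^[n] x

theorem subset_saturate (T : HornSentence n) (Xs : List (Finset (Fin n))) (x : Finset (Fin n)) :
    x ⊆ saturate T Xs x := by
  have : ∀ k, x ⊆ (fun y => Xs.foldl (absorb T) y)^[k] x := fun k => by
    induction k with
    | zero => simp
    | succ k ih =>
      rw [Function.iterate_succ_apply']
      exact ih.trans (subset_foldl_absorb T Xs _)
  exact this n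

theorem entailedVars_subset_saturate {T : HornSentence n} {Xs : List (Finset (Fin n))}
    {x X : Finset (Fin n)} (hX : X ∈ Xs) (h : X ⊆ saturate T Xs x) :
    entailedVars T X ⊆ saturate T Xs x := by
  have := absorb_eq_of_foldl_eq
    (iterate_fixed_of_subset (fun y => subset_foldl_absorb T Xs y) x) X hX
  change absorb T (saturate T Xs x) X = saturate T Xs x at this
  rw [absorb, if_pos h] at this
  exact Finset.union_eq_left.mp this

/-! ### Hypotheses and counterexamples -/

/-- A hypothesis consists of the clauses entailed by `T` with antecedent in the list. -/
def IsHypothesis (T : HornSentence n) (Xs : List (Finset (Fin n))) (H : HornSentence n) : Prop :=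
  ∀ c, c ∈ H ↔ c.ant ∈ Xs ∧ T.Entails c

/-- Soundness of forward chaining: each variable added is the head of a clause of `H` whose
antecedent is already true in `I`. -/
theorem saturate_subset_of_sat {T H : HornSentence n} {Xs : List (Finset (Fin n))}
    (hH : IsHypothesis T Xs H) {I : Interpretation n} (hI : H.Sat I) {x : Finset (Fin n)}
    (hx : ∀ v ∈ x, I v = true) : ∀ v ∈ saturate T Xs x, I v = true := by
  have habs : ∀ X ∈ Xs, ∀ y : Finset (Fin n), (∀ v ∈ y, I v = true) →
      ∀ v ∈ absorb T y X, I v = true := by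
    intro X hX y hy v hv
    rw [absorb] at hv
    split_ifs at hv with hXy
    · rcases Finset.mem_union.mp hv with hv | hv
      · exact hy v hv
      · rcases hI _ ((hH ⟨X, some v⟩).mpr ⟨hX, mem_entailedVars.mp hv⟩) with
          ⟨w, hw, hIw⟩ | ⟨w, hw, hIw⟩
        · simp [hy w (hXy hw)] at hIw
        · rwa [Option.some_injective _ hw]
    · exact hy v hv
  have hfold : ∀ Ys : List (Finset (Fin n)), (∀ X ∈ Ys, X ∈ Xs) → ∀ y : Finset (Fin n),
      (∀ v ∈ y, I v = true) → ∀ v ∈ Ys.foldl (absorb T) y, I v = true := by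
    intro Ys
    induction Ys with
    | nil => intro _ y hy; simpa using hy
    | cons X Ys ih =>
      intro hYs y hy
      exact ih (fun Z hZ => hYs Z (by simp [hZ])) _ (habs X (hYs X (by simp)) y hy)
  have : ∀ k, ∀ v ∈ (fun y => Xs.foldl (absorb T) y)^[k] x, I v = true := fun k => by
    induction k with
    | zero => simpa using hx
    | succ k ih =>
      rw [Function.iterate_succ_apply']
      exact hfold Xs (fun _ => id) _ ih
  exact this n

/-- A counterexample to a hypothesis yields a saturated negative set. -/
theorem IsHypothesis.saturate_spec {T H : HornSentence n} {Xs : List (Finset (Fin n))}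
    (hH : IsHypothesis T Xs H) {e : HornClause n} (he : e ∈ symmDiff {c | H.Entails c}
      {c | T.Entails c}) :
    IsNegative T (saturate T Xs e.ant) ∧ Saturated T Xs (saturate T Xs e.ant) := by
  obtain ⟨hHe, hTe⟩ | ⟨hTe, hHe⟩ := he
  · exact absurd (fun I hI => hHe I fun c hc => ((hH c).mp hc).2 I hI) hTe
  have hTe : T.Entails e := hTe
  have hHe : ¬ H.Entails e := hHe
  simp only [HornSentence.Entails, not_forall] at hHe
  obtain ⟨I, hI, hIe⟩ := hHe
  simp only [HornClause.Sat, not_or, not_exists, not_and, Bool.not_eq_false] at hIe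
  have hsat := saturate_subset_of_sat hH hI hIe.1
  have hsub := subset_saturate T Xs e.ant
  constructor
  · refine isNegative_iff_exists_entails.mpr ⟨e.head, fun J hJ => ?_, fun v hv hvx => ?_⟩
    · rcases hTe J hJ with ⟨v, hv, hJv⟩ | h
      · exact .inl ⟨v, hsub hv, hJv⟩
      · exact .inr h
    · exact hIe.2 v hv (hsat v hvx)
  · intro X hX hXx h hT
    rcases h with - | v
    -- Falsum cannot be entailed from `X`: the clause would belong to `H`, but its model `I` makes
    -- all of `X` true.
    · rcases hI _ ((hH ⟨X, none⟩).mpr ⟨hX, hT⟩) with ⟨w, hw, hIw⟩ | ⟨w, hw, hIw⟩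
      · simp [hsat w (hXx hw)] at hIw
      · simp at hw
    · exact ⟨v, entailedVars_subset_saturate hX hXx (mem_entailedVars.mpr hT), rfl⟩

end Horn
end HornLearning

namespace HornLearning

/-! ### Lists of truth values -/

namespace Code

def true : Code := .cons .nil .nil
def and : Code := .ite (.var 0) (.var 1) .nil
def or : Code := .ite (.var 0) .true (.var 1)
def imp : Code := .ite (.var 0) (.var 1) .true
def reverse : Code := .fold (.var 0) .nil (.cons (.var 3) (.var 2))
/-- Apply `op` elementwise to two lists of the same length. -/
def zip (op : Code) : Code :=
  .call1 .reverse (.tail (.fold (.var 0) (.cons (.var 1) .nil)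
    (.cons (.tail (.head (.var 3)))
      (.cons (.call2 op (.var 4) (.head (.head (.var 3)))) (.tail (.var 3))))))
def all : Code := .fold (.var 0) .true (.ite (.var 2) (.var 3) .nil)
def subset : Code := .call1 .all (.call2 (.zip .imp) (.var 0) (.var 1))
def inter : Code := .zip .and
def union : Code := .zip .or

end Code

/-- The encoding of a list of truth values. -/
def encodeBits (xs : List Bool) : Data := .ofList (xs.map .ofBool)

/-- The encoding of a set of variables, as in `HornClause.encode`. -/
def encodeSet {n : ℕ} (X : Finset (Fin n)) : Data :=
  .ofList (List.ofFn fun v : Fin n => .ofBool (decide (v ∈ X)))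

def bits {n : ℕ} (X : Finset (Fin n)) : List Bool := (List.finRange n).map fun v => decide (v ∈ X)

theorem encodeSet_eq {n : ℕ} (X : Finset (Fin n)) : encodeSet X = encodeBits (bits X) := by
  simp [encodeSet, encodeBits, bits, List.ofFn_eq_map, Function.comp_def]

@[simp] theorem length_bits {n : ℕ} (X : Finset (Fin n)) : (bits X).length = n := by simp [bits]

theorem zipWith_bits {n : ℕ} (g : Bool → Bool → Bool) (X Y Z : Finset (Fin n))
    (h : ∀ v, g (decide (v ∈ X)) (decide (v ∈ Y)) = decide (v ∈ Z)) :
    List.zipWith g (bits X) (bits Y) = bits Z := by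
  simp [bits, List.zipWith_map, List.zipWith_self, h]

theorem foldl_and_eq_all (xs : List Bool) (b : Bool) :
    xs.foldl (fun y x => y && x) b = (b && xs.all id) := by
  induction xs generalizing b with
  | nil => simp
  | cons x xs ih => simp [ih, Bool.and_assoc]

theorem all_zipWith_imp_bits {n : ℕ} (X Y : Finset (Fin n)) :
    (List.zipWith (fun a b => !a || b) (bits X) (bits Y)).all id = decide (X ⊆ Y) := by
  rw [Bool.eq_iff_iff]
  simp [bits, List.zipWith_map, List.zipWith_self, Finset.subset_iff, imp_iff_not_or]

theorem foldl_zip (g : Bool → Bool → Bool) (xs ys out : List Bool) (h : xs.length = ys.length) :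
    (xs.foldl (fun (p : List Bool × List Bool) x => (p.1.tail, g x (p.1.headD false) :: p.2))
      (ys, out)).2 = (List.zipWith g xs ys).reverse ++ out := by
  induction xs generalizing ys out with
  | nil => simp
  | cons x xs ih =>
    cases ys with
    | nil => simp at h
    | cons y ys =>
      rw [List.foldl_cons, List.tail_cons, ih _ _ (by simpa using h)]
      simp

namespace Ev

variable {F : LearningFramework} {l : F.Rep} {op : Code} {env : List Data} {k : ℕ}

theorem true : Ev F l .true env (.ofBool Bool.true) 5 := nil.cons nil

theorem and (a b : Bool) : Ev F l .and [.ofBool a, .ofBool b] (.ofBool (a && b)) 8 := by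
  cases a
  · exact (var rfl).ite (c := 5) (fun h => absurd rfl h) fun _ => nil.conv rfl (by omega)
  · exact (var rfl).ite (c := 5) (fun _ => (var rfl).conv rfl (by omega)) (by simp [Data.ofBool])

theorem or (a b : Bool) : Ev F l .or [.ofBool a, .ofBool b] (.ofBool (a || b)) 8 := by
  cases a
  · exact (var rfl).ite (c := 5) (fun h => absurd rfl h) fun _ => (var rfl).conv rfl (by omega)
  · exact (var rfl).ite (c := 5) (fun _ => true) (by simp [Data.ofBool])

theorem imp (a b : Bool) : Ev F l .imp [.ofBool a, .ofBool b] (.ofBool (!a || b)) 8 := by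
  cases a
  · exact (var rfl).ite (c := 5) (fun h => absurd rfl h) fun _ => true
  · exact (var rfl).ite (c := 5) (fun _ => (var rfl).conv rfl (by omega)) (by simp [Data.ofBool])

theorem reverse {α : Type} (enc : α → Data) (L : List α) :
    Ev F l .reverse [.ofList (L.map enc)] (.ofList (L.reverse.map enc)) (L.length * 12 + 7) := by
  refine (fold (enc' := fun M => .ofList (M.map enc)) (z := []) (g := fun b x => x :: b) (c := 5)
    (var rfl) nil fun r y x _ => (var rfl).cons (var rfl)).conv ?_ (by omega)
  simp

theorem zip {g : Bool → Bool → Bool}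
    (hop : ∀ a b, Ev F l op [.ofBool a, .ofBool b] (.ofBool (g a b)) k) {xs ys : List Bool}
    (h : xs.length = ys.length) :
    Ev F l (.zip op) [encodeBits xs, encodeBits ys] (encodeBits (List.zipWith g xs ys))
      (xs.length * (k + 45) + 30) := by
  have hf := fold (F := F) (l := l) (env := [encodeBits xs, encodeBits ys])
    (enc := Data.ofBool) (L := xs)
    (enc' := fun p : List Bool × List Bool => .cons (encodeBits p.1) (encodeBits p.2))
    (z := (ys, [])) (g := fun p x => (p.1.tail, g x (p.1.headD false) :: p.2)) (c := k + 26)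
    (a₁ := .var 0) (a₂ := .cons (.var 1) .nil)
    (f := .cons (.tail (.head (.var 3)))
      (.cons (.call2 op (.var 4) (.head (.head (.var 3)))) (.tail (.var 3))))
    (var rfl) ((var rfl).cons nil) fun r p x _ => by
      refine (((var (i := 3) rfl).head.tail).cons (((hop x (p.1.headD false)).call2
        (var (i := 4) rfl) (?_ : Ev F l (.head (.head (.var 3))) _ _ 5)).cons
        (var (i := 3) rfl).tail)).conv ?_ (by omega)
      · refine (var (i := 3) rfl).head.head.conv ?_ le_rfl
        -- The head of the empty list is `nil`, the code of `false`, whence the default in `headD`.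
        rcases p with ⟨_ | ⟨y, ys⟩, out⟩ <;> rfl
      · rcases p with ⟨_ | ⟨y, ys⟩, out⟩ <;> rfl
  rw [foldl_zip g xs ys [] h, List.append_nil] at hf
  refine (call1 (reverse Data.ofBool _) hf.tail).conv (by simp [encodeBits]) ?_
  simp only [List.length_reverse, List.length_zipWith, ← h, min_self]
  nlinarith

theorem all (xs : List Bool) :
    Ev F l .all [encodeBits xs] (.ofBool (xs.all id)) (xs.length * 11 + 11) := by
  refine (fold (enc := Data.ofBool) (enc' := Data.ofBool) (L := xs) (z := Bool.true)
    (g := fun y x => y && x) (c := 4) (var rfl) true fun r y x _ => ?_).conv ?_ (by omega)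
  · cases y
    · exact (var rfl).ite (c := 1) (fun h => absurd rfl h) fun _ => nil
    · exact (var rfl).ite (c := 1) (fun _ => var rfl) (by simp [Data.ofBool])
  · simp [foldl_and_eq_all]

variable {n : ℕ} (X Y : Finset (Fin n))

theorem inter : Ev F l .inter [encodeSet X, encodeSet Y] (encodeSet (X ∩ Y)) (53 * n + 30) := by
  rw [encodeSet_eq, encodeSet_eq, encodeSet_eq,
    ← zipWith_bits (fun a b => a && b) X Y (X ∩ Y) (by simp)]
  exact (zip and (by simp)).conv rfl (by simp; omega)

theorem union : Ev F l .union [encodeSet X, encodeSet Y] (encodeSet (X ∪ Y)) (53 * n + 30) := by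
  rw [encodeSet_eq, encodeSet_eq, encodeSet_eq,
    ← zipWith_bits (fun a b => a || b) X Y (X ∪ Y) (by simp)]
  exact (zip or (by simp)).conv rfl (by simp; omega)

theorem subset : Ev F l .subset [encodeSet X, encodeSet Y] (.ofBool (decide (X ⊆ Y)))
    (64 * n + 60) := by
  rw [encodeSet_eq, encodeSet_eq, ← all_zipWith_imp_bits]
  exact (call1 (all _) (call2 (zip imp (by simp)) (var rfl) (var rfl))).conv rfl
    (by simp; omega)

end Ev
end HornLearning

namespace HornLearning

/-! ### Sizes of encodings -/

theorem Data.size_ofList_le {L : List Data} {k : ℕ} (h : ∀ d ∈ L, d.size ≤ k) :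
    (Data.ofList L).size ≤ L.length * (k + 1) + 1 := by
  induction L with
  | nil => simp [Data.ofList, Data.size]
  | cons d L ih =>
    have h1 := ih fun e he => h e (by simp [he])
    have h2 := h d (by simp)
    simp only [Data.ofList, Data.size, List.length_cons]
    nlinarith

/-- The encoding of the consequent of a clause, as in `HornClause.encode`. -/
def encodeHead {n : ℕ} (h : Option (Fin n)) : Data := .ofList (h.toList.map fun v : Fin n => .ofNat v)

theorem HornClause.encode_eq {n : ℕ} (c : HornClause n) :
    c.encode = .cons (encodeSet c.ant) (encodeHead c.head) := by
  rcases c with ⟨X, _ | v⟩ <;> rfl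

theorem size_encodeSet_le {n : ℕ} (X : Finset (Fin n)) : (encodeSet X).size ≤ 4 * n + 1 := by
  refine (Data.size_ofList_le (k := 3) fun d hd => ?_).trans (by simp; omega)
  obtain ⟨v, rfl⟩ := List.mem_ofFn.mp hd
  cases decide (v ∈ X) <;> simp [Data.ofBool, Data.size]

theorem size_encodeHead_le {n : ℕ} (h : Option (Fin n)) : (encodeHead h).size ≤ 2 * n + 3 := by
  cases h with
  | none => simp [encodeHead, Data.ofList, Data.size]
  | some v =>
    have h1 : (Data.ofNat v).size ≤ 2 * v + 1 :=
      (Data.size_ofList_le (k := 1) fun d hd => by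
        rw [List.eq_of_mem_replicate hd]; simp [Data.size]).trans (by simp; omega)
    have := v.isLt
    simp only [encodeHead, Option.toList, List.map, Data.ofList, Data.size]
    omega

theorem HornClause.size_encode_le {n : ℕ} (c : HornClause n) : c.encode.size ≤ 6 * n + 5 := by
  have h1 := size_encodeSet_le c.ant
  have h2 := size_encodeHead_le c.head
  rw [c.encode_eq, Data.size]
  omega

theorem HornSentence.size_encode_le {n : ℕ} (H : HornSentence n) :
    (HornSentence.encode H).size ≤ List.length H * (6 * n + 6) + 1 := by
  refine (Data.size_ofList_le (k := 6 * n + 5) fun d hd => ?_).trans (by simp)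
  obtain ⟨c, -, rfl⟩ := List.mem_map.mp hd
  exact c.size_encode_le

/-! ### The subroutines of the learner -/

namespace Code

/-- The list of all variables, given their number. -/
def vars : Code :=
  .tail (.fold (.var 0) (.cons .nil .nil)
    (.cons (.cons .nil (.head (.var 2)))
      (.cons (.cons (.head (.var 2)) .nil) (.tail (.var 2)))))
/-- The set of variables entailed by a set, given the number of variables and the set. -/
def entailedVars : Code :=
  .fold (.call1 .vars (.var 0)) .nil (.cons (.mem (.cons (.var 1) (.var 4))) (.var 3))
/-- Whether a set is negative, given the number of variables and the set. -/
def negative : Code :=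
  .ite (.mem (.cons (.var 1) .nil)) .true
    (.ite (.call2 .subset (.call2 .entailedVars (.var 0) (.var 1)) (.var 1)) .nil .true)
def saturate : Code :=
  .fold (.var 0) (.var 2) (.fold (.var 1) (.var 4)
    (.ite (.call2 .subset (.var 8) (.var 7))
      (.call2 .union (.var 7) (.call2 .entailedVars (.var 0) (.var 8))) (.var 7)))
def keep : Code := .cons (.head (.var 4)) (.cons (.var 5) (.tail (.var 4)))
def refineStep : Code :=
  .ite (.head (.var 4)) .keep
    (.ite (.call2 .subset (.var 5) (.var 2)) .keep
      (.ite (.call2 .negative (.var 0) (.call2 .inter (.var 5) (.var 2)))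
        (.cons .true (.cons (.call2 .inter (.var 5) (.var 2)) (.tail (.var 4)))) .keep))
def refine : Code :=
  .bind (.fold (.var 1) (.cons .nil .nil) .refineStep)
    (.call1 .reverse
      (.ite (.head (.var 3)) (.tail (.var 3)) (.cons (.var 2) (.tail (.var 3)))))
/-- The new list of sets, given the number of variables, the list and an answer of the equivalence
oracle. -/
def update : Code :=
  .call3 .refine (.var 0) (.var 1) (.call3 .saturate (.var 0) (.var 1) (.head (.head (.var 2))))
/-- The hypothesis, given the number of variables and the list of sets. -/
def hypothesis : Code :=
  .bind (.cons .nil (.call1 .vars (.var 0)))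
    (.fold (.var 1) .nil (.fold (.var 2) (.var 4)
      (.ite (.mem (.cons (.var 5) (.var 8))) (.cons (.cons (.var 5) (.var 8)) (.var 7))
        (.var 7))))

end Code

def encodeSets {n : ℕ} (Xs : List (Finset (Fin n))) : Data := .ofList (Xs.map encodeSet)

/-! ### The hypothesis as a nested fold -/

section Hypothesis

variable {n : ℕ}

open Classical in
noncomputable def addClause (T : HornSentence n) (X : Finset (Fin n)) (H : HornSentence n)
    (h : Option (Fin n)) : HornSentence n :=
  if T.Entails ⟨X, h⟩ then ⟨X, h⟩ :: H else H

/-- Falsum first, then the variables in descending order, as the program `vars` lists them. -/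
def allHeads (n : ℕ) : List (Option (Fin n)) := none :: (List.finRange n).reverse.map some

theorem mem_allHeads (h : Option (Fin n)) : h ∈ allHeads n := by
  cases h <;> simp [allHeads]

@[simp] theorem length_allHeads : (allHeads n).length = n + 1 := by simp [allHeads]

noncomputable def hypothesis (T : HornSentence n) (Xs : List (Finset (Fin n))) : HornSentence n :=
  Xs.foldl (fun H X => (allHeads n).foldl (addClause T X) H) []

theorem mem_foldl_addClause {T : HornSentence n} {X : Finset (Fin n)} {H : HornSentence n}
    {hs : List (Option (Fin n))} {c : HornClause n} :
    c ∈ hs.foldl (addClause T X) H ↔ c ∈ H ∨ (c.ant = X ∧ c.head ∈ hs ∧ T.Entails c) := by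
  induction hs generalizing H with
  | nil => simp
  | cons h hs ih =>
    rw [List.foldl_cons, ih, addClause]
    split_ifs with hT
    · simp only [List.mem_cons]
      constructor
      · rintro ((rfl | h1) | h1)
        · exact .inr ⟨rfl, .inl rfl, hT⟩
        · exact .inl h1
        · exact .inr ⟨h1.1, .inr h1.2.1, h1.2.2⟩
      · rintro (h1 | ⟨rfl, rfl | h1, h2⟩)
        · exact .inl (.inr h1)
        · exact .inl (.inl rfl)
        · exact .inr ⟨rfl, h1, h2⟩
    · simp only [List.mem_cons]
      constructor
      · rintro (h1 | h1)
        · exact .inl h1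
        · exact .inr ⟨h1.1, .inr h1.2.1, h1.2.2⟩
      · rintro (h1 | ⟨rfl, rfl | h1, h2⟩)
        · exact .inl h1
        · exact absurd h2 hT
        · exact .inr ⟨rfl, h1, h2⟩

theorem isHypothesis_hypothesis (T : HornSentence n) (Xs : List (Finset (Fin n))) :
    IsHypothesis T Xs (hypothesis T Xs) := by
  have key : ∀ (Ys : List (Finset (Fin n))) (H : HornSentence n) (c : HornClause n),
      c ∈ Ys.foldl (fun H X => (allHeads n).foldl (addClause T X) H) H ↔
        c ∈ H ∨ (c.ant ∈ Ys ∧ T.Entails c) := by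
    intro Ys
    induction Ys with
    | nil => simp
    | cons X Ys ih =>
      intro H c
      rw [List.foldl_cons, ih, mem_foldl_addClause]
      simp only [mem_allHeads, List.mem_cons, true_and]
      tauto
  intro c
  rw [hypothesis, key]
  simp

theorem length_hypothesis_le (T : HornSentence n) (Xs : List (Finset (Fin n))) :
    List.length (hypothesis T Xs) ≤ Xs.length * (n + 1) := by
  have h1 : ∀ (hs : List (Option (Fin n))) (X : Finset (Fin n)) (H : HornSentence n),
      List.length (hs.foldl (addClause T X) H) ≤ List.length H + hs.length := by
    intro hs X
    induction hs with
    | nil => simp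
    | cons h hs ih =>
      intro H
      have : List.length (addClause T X H h) ≤ List.length H + 1 := by
        rw [addClause]; split_ifs <;> simp
      have := ih (addClause T X H h)
      simp only [List.foldl_cons, List.length_cons]
      omega
  have h2 : ∀ (Ys : List (Finset (Fin n))) (H : HornSentence n),
      List.length (Ys.foldl (fun H X => (allHeads n).foldl (addClause T X) H) H) ≤
        List.length H + Ys.length * (n + 1) := by
    intro Ys
    induction Ys with
    | nil => simp
    | cons X Ys ih =>
      intro H
      have h3 := ih ((allHeads n).foldl (addClause T X) H)
      have h4 := h1 (allHeads n) X H
      rw [length_allHeads] at h4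
      simp only [List.foldl_cons, List.length_cons]
      nlinarith
  exact (h2 Xs []).trans (by simp)

end Hypothesis

/-! ### Values of the single-pass folds -/

section Fold

variable {n : ℕ}

open Classical in
/-- One step of a single pass computing `refine`; the flag tells whether a set was replaced. -/
noncomputable def refineStep (T : HornSentence n) (x : Finset (Fin n))
    (p : Bool × List (Finset (Fin n))) (X : Finset (Fin n)) : Bool × List (Finset (Fin n)) :=
  if p.1 = true ∨ X ⊆ x ∨ ¬ IsNegative T (X ∩ x) then (p.1, X :: p.2) else (true, X ∩ x :: p.2)

/-- Once the flag is set, the remaining sets are copied. If it is still unset at the end, nothing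
was replaced and `x` is pushed; the accumulator is reversed, so this appends it. -/
theorem reverse_foldl_refineStep (T : HornSentence n) (x : Finset (Fin n))
    (Xs out : List (Finset (Fin n))) :
    (if (Xs.foldl (refineStep T x) (false, out)).1 then (Xs.foldl (refineStep T x) (false, out)).2
      else x :: (Xs.foldl (refineStep T x) (false, out)).2).reverse =
      out.reverse ++ refine T x Xs := by
  have htrue : ∀ Ys out : List (Finset (Fin n)), Ys.foldl (refineStep T x) (true, out) = (true, Ys.reverse ++ out) := by
    intro Ys
    induction Ys with
    | nil => simp
    | cons Y Ys ih => intro out; simp [refineStep, ih]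
  induction Xs generalizing out with
  | nil => simp [refine]
  | cons X Xs ih =>
    rw [List.foldl_cons, refine]
    by_cases h : ¬ X ⊆ x ∧ IsNegative T (X ∩ x)
    · have : refineStep T x (false, out) X = (true, X ∩ x :: out) := by
        simp [refineStep, h.1, h.2]
      rw [this, htrue, if_pos h]
      simp
    · have : refineStep T x (false, out) X = (false, X :: out) := by
        rw [refineStep, if_pos (by tauto)]
      rw [this, ih, if_neg h]
      simp

theorem length_foldl_refineStep (T : HornSentence n) (x : Finset (Fin n))
    (Xs : List (Finset (Fin n))) (p : Bool × List (Finset (Fin n))) :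
    (Xs.foldl (refineStep T x) p).2.length = Xs.length + p.2.length := by
  induction Xs generalizing p with
  | nil => simp
  | cons X Xs ih =>
    rw [List.foldl_cons, ih, refineStep]
    split_ifs <;> simp <;> omega

theorem foldl_vars (n : ℕ) :
    (List.replicate n ()).foldl (fun (p : ℕ × List ℕ) _ => (p.1 + 1, p.1 :: p.2)) (0, []) =
      (n, (List.range n).reverse) := by
  induction n with
  | zero => simp
  | succ n ih => rw [List.replicate_succ', List.foldl_append, ih]; simp [List.range_succ]

/-- Pushing reverses, so the descending enumeration of variables yields the bits in ascending order.
-/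
theorem foldl_entailedVars (f : Fin n → Bool) (L : List (Fin n)) (out : List Bool) :
    L.reverse.foldl (fun out v => f v :: out) out = L.map f ++ out := by
  induction L generalizing out with
  | nil => simp
  | cons v L ih => simp [ih]

end Fold

/-! ### Correctness and running time of the subroutines -/

namespace Ev

variable {n : ℕ} {T : HornSentence n} {env : List Data} {a a' : Code} {c c' : ℕ}

theorem vars {F : LearningFramework} {l : F.Rep} :
    Ev F l .vars [.ofNat n] (.ofList ((List.finRange n).reverse.map fun v => encodeHead (some v)))
      (30 * n + 15) := by
  have hn : Data.ofNat n = .ofList ((List.replicate n ()).map fun _ => .nil) := by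
    simp [Data.ofNat]
  rw [hn]
  have hf := fold (F := F) (l := l) (env := [.ofList ((List.replicate n ()).map fun _ => .nil)])
    (enc := fun _ => .nil) (L := List.replicate n ())
    (enc' := fun p : ℕ × List ℕ =>
      .cons (.ofNat p.1) (.ofList (p.2.map fun v => .ofList [.ofNat v])))
    (z := (0, [])) (g := fun p _ => (p.1 + 1, p.1 :: p.2)) (c := 23)
    (a₁ := .var 0) (a₂ := .cons .nil .nil)
    (f := .cons (.cons .nil (.head (.var 2)))
      (.cons (.cons (.head (.var 2)) .nil) (.tail (.var 2))))
    (var rfl) (nil.cons nil) fun r p x _ =>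
      ((nil.cons (var (i := 2) rfl).head).cons
        (((var (i := 2) rfl).head.cons nil).cons (var (i := 2) rfl).tail)).conv rfl (by omega)
  rw [foldl_vars] at hf
  refine hf.tail.conv ?_ (by simp; omega)
  have hr : List.range n = (List.finRange n).map fun v : Fin n => (v : ℕ) := by
    simp
  simp only [Data.tail, hr, ← List.map_reverse, List.map_map]
  rfl

open Classical in
theorem entails {X : Finset (Fin n)} {h : Option (Fin n)}
    (h₁ : Ev (hornFromEntailments n) T a env (encodeSet X) c)
    (h₂ : Ev (hornFromEntailments n) T a' (env ++ [encodeSet X]) (encodeHead h) c') :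
    Ev (hornFromEntailments n) T (.mem (.cons a a')) env (.ofBool (decide (T.Entails ⟨X, h⟩)))
      (c + c' + 6 * n + 10) := by
  have hsize := HornClause.size_encode_le (⟨X, h⟩ : HornClause n)
  refine (mem (F := hornFromEntailments n) (l := T) (e := (⟨X, h⟩ : HornClause n))
    ((h₁.cons h₂).conv (HornClause.encode_eq ⟨X, h⟩).symm le_rfl)).conv rfl ?_
  change c + c' + 3 + (HornClause.encode _).size + 2 ≤ _
  omega

theorem entailedVars (X : Finset (Fin n)) :
    Ev (hornFromEntailments n) T .entailedVars [.ofNat n, encodeSet X]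
      (encodeSet (HornLearning.entailedVars T X)) (6 * n * n + 53 * n + 30) := by
  classical
  refine (fold (enc := fun v : Fin n => encodeHead (some v)) (L := (List.finRange n).reverse)
    (enc' := encodeBits) (z := []) (g := fun out v => decide (T.Entails ⟨X, some v⟩) :: out)
    (c := 6 * n + 16) (call1 vars (var rfl)) nil fun r y v _ => ?_).conv ?_ ?_
  · exact ((entails (X := X) (h := some v) (var rfl) (var rfl)).cons (var rfl)).conv rfl (by omega)
  · rw [foldl_entailedVars, List.append_nil, encodeSet_eq, bits]
    simp [mem_entailedVars]
  · simp only [List.length_reverse, List.length_finRange]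
    nlinarith

open Classical in
theorem negative (X : Finset (Fin n)) :
    Ev (hornFromEntailments n) T .negative [.ofNat n, encodeSet X]
      (.ofBool (decide (IsNegative T X))) (6 * n * n + 130 * n + 140) := by
  refine (ite_bool (c := 6 * n * n + 117 * n + 120)
    (entails (X := X) (h := none) (var rfl) nil) (fun h => ?_) fun h => ?_).conv rfl (by omega)
  · have hX : IsNegative T X := isNegative_iff_exists_entails.mpr ⟨none, h, by simp⟩
    exact true.conv (by simp [hX]) (by omega)
  · refine (ite_bool (c := 5) (call2 (subset _ _) (call2 (entailedVars X) (var rfl) (var rfl))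
      (var rfl)) (fun hs => ?_) fun hs => ?_).conv rfl (by omega)
    · have hX : ¬ IsNegative T X := fun hX => by
        obtain ⟨_ | v, hv, hvX⟩ := isNegative_iff_exists_entails.mp hX
        · exact h hv
        · exact hvX v rfl (hs (mem_entailedVars.mpr hv))
      exact nil.conv (by simp [hX, Data.ofBool]) (by omega)
    · have hX : IsNegative T X := by
        obtain ⟨v, hv, hvX⟩ := Finset.not_subset.mp hs
        refine isNegative_iff_exists_entails.mpr ⟨some v, mem_entailedVars.mp hv, ?_⟩
        rintro _ ⟨⟩
        exact hvX
      exact true.conv (by simp [hX]) (by omega)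

/-- A bound for the time of a pass over `k` sets. -/
def _root_.HornLearning.passTime (n k : ℕ) : ℕ := k * (6 * n * n + 400 * n + 400) + 20

theorem saturate (Xs : List (Finset (Fin n))) (x : Finset (Fin n)) :
    Ev (hornFromEntailments n) T .saturate [.ofNat n, encodeSets Xs, encodeSet x]
      (encodeSet (HornLearning.saturate T Xs x)) (n * (passTime n Xs.length + 10) + 10) := by
  have hn : Data.ofNat n = .ofList ((List.replicate n ()).map fun _ => .nil) := by
    simp [Data.ofNat]
  refine (fold (enc := fun _ => .nil) (L := List.replicate n ()) (enc' := encodeSet) (z := x)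
    (g := fun y _ => Xs.foldl (absorb T) y) (c := passTime n Xs.length)
    ((var rfl).conv hn le_rfl) (var rfl) fun r y _ _ => ?_).conv ?_ ?_
  · refine (fold (enc := encodeSet) (L := Xs) (enc' := encodeSet) (z := y) (g := absorb T)
      (c := 6 * n * n + 250 * n + 250) (var rfl) (var rfl) fun r' z X _ => ?_).conv rfl ?_
    · refine (ite_bool (c := 6 * n * n + 117 * n + 100) (call2 (subset X z) (var rfl) (var rfl))
        (fun h => ?_) fun h => ?_).conv rfl (by omega)
      · rw [absorb, if_pos h]
        exact (call2 (union _ _) (var rfl) (call2 (entailedVars X) (var rfl) (var rfl))).conv rfl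
          (by omega)
      · rw [absorb, if_neg h]
        exact (var rfl).conv rfl (by omega)
    · rw [passTime]
      nlinarith
  · rw [List.foldl_const, List.length_replicate, HornLearning.saturate]
  · rw [List.length_replicate]
    nlinarith

theorem keep {F : LearningFramework} {l : F.Rep} {d₀ d₁ d₂ d₃ f o x : Data} :
    Ev F l .keep [d₀, d₁, d₂, d₃, .cons f o, x] (.cons f (.cons x o)) 13 :=
  (var (v := .cons f o) rfl).head.cons ((var rfl).cons (var (i := 4) (v := .cons f o) rfl).tail)

theorem refineStep (x : Finset (Fin n)) (d r : Data) (p : Bool × List (Finset (Fin n)))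
    (X : Finset (Fin n)) :
    Ev (hornFromEntailments n) T .refineStep
      [.ofNat n, d, encodeSet x, r, .cons (.ofBool p.1) (encodeSets p.2), encodeSet X]
      (.cons (.ofBool (HornLearning.refineStep T x p X).1)
        (encodeSets (HornLearning.refineStep T x p X).2)) (6 * n * n + 380 * n + 380) := by
  classical
  obtain ⟨b, out⟩ := p
  have hk : (b = Bool.true ∨ X ⊆ x ∨ ¬ IsNegative T (X ∩ x)) →
      Ev (hornFromEntailments n) T .keep
      [.ofNat n, d, encodeSet x, r, .cons (.ofBool b) (encodeSets out), encodeSet X]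
      (.cons (.ofBool (HornLearning.refineStep T x (b, out) X).1)
        (encodeSets (HornLearning.refineStep T x (b, out) X).2)) 13 := fun h => by
    rw [HornLearning.refineStep, if_pos h]
    exact keep
  refine (ite_bool (p := b = Bool.true) (c := 6 * n * n + 310 * n + 340)
    ((var rfl).head.conv (by simp [Data.head]) le_rfl) (fun h => (hk (.inl h)).conv rfl (by omega))
    fun h₁ => ?_).conv rfl (by omega)
  refine (ite_bool (c := 6 * n * n + 240 * n + 250) (call2 (subset X x) (var rfl) (var rfl))
    (fun h => (hk (.inr (.inl h))).conv rfl (by omega)) fun h₂ => ?_).conv rfl (by omega)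
  refine (ite_bool (c := 53 * n + 60) (call2 (negative (X ∩ x)) (var rfl)
    (call2 (inter X x) (var rfl) (var rfl))) (fun h₃ => ?_)
    fun h => (hk (.inr (.inr h))).conv rfl (by omega)).conv rfl (by omega)
  rw [HornLearning.refineStep, if_neg (by tauto)]
  exact (true.cons ((call2 (inter X x) (var rfl) (var rfl)).cons (var (i := 4) rfl).tail)).conv
    rfl (by omega)

theorem refine (Xs : List (Finset (Fin n))) (x : Finset (Fin n)) :
    Ev (hornFromEntailments n) T .refine [.ofNat n, encodeSets Xs, encodeSet x]
      (encodeSets (HornLearning.refine T x Xs)) (passTime n Xs.length + 50) := by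
  have hf := fold (F := hornFromEntailments n) (l := T)
    (env := [.ofNat n, encodeSets Xs, encodeSet x]) (enc := encodeSet) (L := Xs)
    (enc' := fun p : Bool × List (Finset (Fin n)) => .cons (.ofBool p.1) (encodeSets p.2))
    (z := (false, [])) (g := HornLearning.refineStep T x) (c := 6 * n * n + 380 * n + 380)
    (a₁ := .var 1) (a₂ := .cons .nil .nil) (f := .refineStep)
    (var rfl) (nil.cons nil) fun r p X _ => refineStep x _ r p X
  have hr := reverse_foldl_refineStep T x Xs []
  have hlen := length_foldl_refineStep T x Xs (false, [])
  generalize Xs.foldl (HornLearning.refineStep T x) (false, []) = q at hf hr hlen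
  simp only [List.reverse_nil, List.nil_append] at hr
  rw [← hr]
  have ho : Ev (hornFromEntailments n) T
      (.ite (.head (.var 3)) (.tail (.var 3)) (.cons (.var 2) (.tail (.var 3))))
      ([.ofNat n, encodeSets Xs, encodeSet x] ++ [.cons (.ofBool q.1) (encodeSets q.2)])
      (encodeSets (if q.1 = Bool.true then q.2 else x :: q.2)) 12 := by
    refine ite_bool (p := q.1 = Bool.true) (c := 7)
      ((var (i := 3) (v := .cons (.ofBool q.1) (encodeSets q.2)) rfl).head.conv
        (by simp [Data.head]) le_rfl) (fun h => ?_) fun h => ?_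
    · rw [if_pos h]
      exact (var (i := 3) (v := .cons (.ofBool q.1) (encodeSets q.2)) rfl).tail.conv rfl (by omega)
    · rw [if_neg h]
      exact (var rfl).cons (var (i := 3) (v := .cons (.ofBool q.1) (encodeSets q.2)) rfl).tail
  refine (hf.bind (call1 (reverse encodeSet _) ho)).conv rfl ?_
  · have : (if q.1 = Bool.true then q.2 else x :: q.2).length ≤ Xs.length + 1 := by
      split_ifs <;> simp [hlen]
    rw [passTime]
    nlinarith

theorem update (Xs : List (Finset (Fin n))) (e : HornClause n) :
    Ev (hornFromEntailments n) T .update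
      [.ofNat n, encodeSets Xs, .cons ((hornFromEntailments n).encodeExample e) .nil]
      (encodeSets (HornLearning.refine T (HornLearning.saturate T Xs e.ant) Xs))
      ((n + 1) * (passTime n Xs.length + 10) + 100) := by
  refine (call3 (refine Xs _) (var rfl) (var rfl) (call3 (saturate Xs e.ant) (var rfl) (var rfl)
    ((var (i := 2) (v := .cons e.encode .nil) rfl).head.head.conv
      (by rw [e.encode_eq]; rfl) le_rfl))).conv rfl ?_
  nlinarith

theorem hypothesis (Xs : List (Finset (Fin n))) :
    Ev (hornFromEntailments n) T .hypothesis [.ofNat n, encodeSets Xs]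
      (HornSentence.encode (HornLearning.hypothesis T Xs))
      (Xs.length * ((n + 1) * (6 * n + 60) + 30) + 30 * n + 50) := by
  classical
  have hh : Ev (hornFromEntailments n) T (.cons .nil (.call1 .vars (.var 0)))
      [.ofNat n, encodeSets Xs] (.ofList ((allHeads n).map encodeHead)) (30 * n + 25) :=
    (nil.cons (call1 vars (var rfl))).conv
      (by simp [allHeads, encodeHead, Data.ofList, Function.comp_def]) (by omega)
  refine (hh.bind (fold (enc := encodeSet) (L := Xs) (enc' := HornSentence.encode) (z := [])
    (g := fun H X => (allHeads n).foldl (addClause T X) H)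
    (c := (n + 1) * (6 * n + 60) + 10) (var rfl) nil fun r H X _ => ?_)).conv rfl (by nlinarith)
  refine (fold (enc := encodeHead) (L := allHeads n) (enc' := HornSentence.encode) (z := H)
    (g := addClause T X) (c := 6 * n + 30) (var rfl) (var rfl) fun r' H' h _ => ?_).conv rfl
    (by rw [length_allHeads]; nlinarith)
  refine (ite_bool (c := 11) (entails (X := X) (h := h) (var rfl) (var rfl)) (fun hT => ?_)
    fun hT => ?_).conv rfl (by omega)
  · rw [addClause, if_pos hT]
    exact (((var rfl).cons (var rfl)).cons (var rfl)).conv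
      (by change _ = Data.cons (HornClause.encode ⟨X, h⟩) _; rw [HornClause.encode_eq]; rfl) (by omega)
  · rw [addClause, if_neg hT]
    exact (var rfl).conv rfl (by omega)

end Ev
end HornLearning

namespace HornLearning

/-! ### The learner -/

/-- Write the hypothesis for the number of variables in register `0` and the list of sets in
register `1` to register `2`, and replace it by the answer to the equivalence query. -/
def askHypothesis : Program := .seq (Code.hypothesis 0 2) (.askEq 2 2)

/-- Register 1 starts as `nil`, the empty list of sets, and the answer "yes" is `nil`, which ends
the loop. The answer has overwritten the hypothesis, so it is computed again for output. -/
def learner : Program :=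
  .seq askHypothesis (.seq
    (.loop 2 (.seq (Code.update 0 3) (.seq (.copy 1 3) askHypothesis)))
    (.seq (Code.hypothesis 0 2) (.copy 0 2)))

/-! ### The polynomial bound -/

section Time

variable {R : Type*} [CommSemiring R]

/-- A general semiring lets the same formulas serve as numbers at `|T|` and as polynomials in a
variable. -/
def hypothesisTime (N : R) : R := N * ((N + 1) * (6 * N + 60) + 30) + 30 * N + 50
def hypothesisSize (N : R) : R := N * (N + 1) * (6 * N + 6) + 1
def askTime (N : R) : R := hypothesisTime N + (1 + hypothesisSize N) + 1
def updateTime (N : R) : R := (N + 1) * (N * (6 * N * N + 400 * N + 400) + 20 + 10) + 100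
def roundTime (N : R) : R := updateTime N + (1 + askTime N + 1) + 1
def learnTime (N : R) : R :=
  askTime N + (N * (N + 1) * (roundTime N + 1) + 1 + (hypothesisTime N + 1 + 1) + 1) + 1 +
    hypothesisSize N

theorem eval_learnTime (f : Fin 2 → ℕ) :
    MvPolynomial.eval f (learnTime (MvPolynomial.X 0)) = learnTime (f 0) := by
  simp [learnTime, roundTime, updateTime, askTime, hypothesisSize, hypothesisTime]

end Time

/-! ### The main loop -/

section Learner

variable {n : ℕ} {T : HornSentence n} {Xs : List (Finset (Fin n))}

theorem HornSentence.card_vars_le_length (T : HornSentence n) : n ≤ T.length := by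
  simp [HornSentence.length]

theorem Admissible.size_hypothesis_le (h : Admissible T Xs) :
    (HornSentence.encode (hypothesis T Xs)).size ≤ hypothesisSize T.length := by
  refine (HornSentence.size_encode_le _).trans ?_
  have h1 := T.card_vars_le_length
  have h2 := h.length_le
  rw [hypothesisSize]
  gcongr
  refine (length_hypothesis_le T Xs).trans ?_
  gcongr

theorem Admissible.ev_hypothesis (h : Admissible T Xs) :
    Ev (hornFromEntailments n) T .hypothesis [.ofNat n, encodeSets Xs]
      (HornSentence.encode (hypothesis T Xs)) (hypothesisTime T.length) := by
  refine (Ev.hypothesis Xs).conv rfl ?_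
  have h1 := T.card_vars_le_length
  have h2 := h.length_le
  rw [hypothesisTime]
  gcongr

theorem Admissible.ev_update (h : Admissible T Xs) (e : HornClause n) :
    Ev (hornFromEntailments n) T .update
      [.ofNat n, encodeSets Xs, .cons ((hornFromEntailments n).encodeExample e) .nil]
      (encodeSets (HornLearning.refine T (saturate T Xs e.ant) Xs)) (updateTime T.length) := by
  refine (Ev.update Xs e).conv rfl ?_
  have h1 := T.card_vars_le_length
  have h2 := h.length_le
  rw [updateTime, passTime]
  gcongr

/-- The value `d` is an answer to the equivalence query for the hypothesis given by `Xs`. -/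
def IsAnswer (T : HornSentence n) (Xs : List (Finset (Fin n))) (d : Data) : Prop :=
  let F := hornFromEntailments n
  (d = .nil ∧ F.concept (hypothesis T Xs) = F.concept T) ∨
    ∃ e ∈ symmDiff (F.concept (hypothesis T Xs)) (F.concept T), d = .cons (F.encodeExample e) .nil

theorem Admissible.triple_hypothesis (h : Admissible T Xs) {s : ℕ → Data} (h0 : s 0 = .ofNat n)
    (h1 : s 1 = encodeSets Xs) :
    Triple (hornFromEntailments n) T s (Code.hypothesis 0 2) (hypothesisTime T.length)
      (fun s' => s' 0 = .ofNat n ∧ s' 1 = encodeSets Xs ∧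
        s' 2 = HornSentence.encode (hypothesis T Xs)) := by
  refine (h.ev_hypothesis 0 s ?_).mono le_rfl fun s' hs' =>
    ⟨?_, ?_, hs'.1⟩
  · intro i hi
    match i, hi with
    | 0, _ => exact h0
    | 1, _ => exact h1
  · rw [hs'.2 0 (by simp), h0]
  · rw [hs'.2 1 (by simp), h1]

theorem Admissible.triple_askHypothesis (h : Admissible T Xs) {s : ℕ → Data}
    (h0 : s 0 = .ofNat n) (h1 : s 1 = encodeSets Xs) :
    Triple (hornFromEntailments n) T s askHypothesis (askTime T.length)
      (fun s' => s' 0 = .ofNat n ∧ s' 1 = encodeSets Xs ∧ IsAnswer T Xs (s' 2)) := by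
  refine (h.triple_hypothesis h0 h1).seq fun s' ⟨h0', h1', h2'⟩ => ?_
  have hsize := h.size_hypothesis_le
  rw [← h2'] at hsize
  refine (Triple.askEq (F := hornFromEntailments n) (l := T) (r := hypothesis T Xs)
    (Q := fun s' => s' 0 = .ofNat n ∧ s' 1 = encodeSets Xs ∧ IsAnswer T Xs (s' 2)) h2'
    (fun heq => ?_) fun e he => ?_).mono (by omega) fun _ => id
  · exact ⟨by simp [h0'], by simp [h1'], .inl ⟨by simp, heq⟩⟩
  · exact ⟨by simp [h0'], by simp [h1'], .inr ⟨e, he, by simp⟩⟩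

theorem Admissible.triple_round (h : Admissible T Xs) {s : ℕ → Data}
    (h0 : s 0 = .ofNat n) (h1 : s 1 = encodeSets Xs) {e : HornClause n}
    (he : e ∈ symmDiff {c | HornSentence.Entails (hypothesis T Xs) c} {c | T.Entails c})
    (h2 : s 2 = .cons ((hornFromEntailments n).encodeExample e) .nil) :
    Triple (hornFromEntailments n) T s
      (.seq (Code.update 0 3) (.seq (.copy 1 3) askHypothesis)) (roundTime T.length)
      (fun s' => ∃ Ys, Admissible T Ys ∧ progress Xs < progress Ys ∧ s' 0 = .ofNat n ∧
        s' 1 = encodeSets Ys ∧ IsAnswer T Ys (s' 2)) := by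
  obtain ⟨hneg, hsat⟩ := (isHypothesis_hypothesis T Xs).saturate_spec he
  have hY := h.refine hneg hsat
  refine (h.ev_update e 0 s ?_).seq fun s' hs' => ?_
  · intro i hi
    match i, hi with
    | 0, _ => exact h0
    | 1, _ => exact h1
    | 2, _ => exact h2
  · obtain ⟨h3, hs'⟩ := hs'
    change s' 3 = _ at h3
    refine (Triple.copy (Q := fun s'' => s'' = Function.update s' 1 (s' 3)) rfl).seq ?_
    rintro _ rfl
    refine (hY.triple_askHypothesis ?_ ?_).mono le_rfl fun s'' hs'' =>
      ⟨_, hY, progress_lt_refine T _ Xs, hs''⟩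
    · rw [Function.update_of_ne (by simp), hs' 0 (by simp), h0]
    · rw [Function.update_self, h3]

theorem Admissible.nil : Admissible T [] := ⟨by simp, .nil⟩

/-- The loop variant is the gap between `progress` and its bound `|T| * (|T| + 1)`. The subtracted
`hypothesisSize` is reserved for writing the output. -/
theorem triple_learner (T : HornSentence n) :
    Triple (hornFromEntailments n) T (Function.update (fun _ => .nil) 0 (.ofNat n)) learner
      (learnTime T.length - hypothesisSize T.length) (fun s' => ∃ H : HornSentence n,
        s' 0 = HornSentence.encode H ∧
        (hornFromEntailments n).concept H = (hornFromEntailments n).concept T ∧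
        (s' 0).size ≤ hypothesisSize T.length) := by
  rw [learnTime, Nat.add_sub_cancel]
  refine (Admissible.nil.triple_askHypothesis (by simp) (by simp [encodeSets, Data.ofList])).seq
    fun s₁ ⟨h0, h1, h2⟩ => Triple.seq (b := T.length * (T.length + 1) * (roundTime T.length + 1) + 1)
    (Triple.loop (I := fun j s => ∃ Xs, Admissible T Xs ∧ j + progress Xs = T.length *
      (T.length + 1) ∧ s 0 = .ofNat n ∧ s 1 = encodeSets Xs ∧ IsAnswer T Xs (s 2)) ?_ _ s₁
      ⟨[], .nil, by simp [progress], h0, h1, h2⟩) ?_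
  · rintro j s ⟨Xs, hXs, hj, h0, h1, h2 | ⟨e, he, h2⟩⟩ hne
    · exact absurd h2.1 hne
    · have hle : ∀ Ys, Admissible T Ys → progress Ys ≤ T.length * (T.length + 1) :=
        fun Ys hYs => (progress_le Ys).trans
          (Nat.mul_le_mul hYs.length_le (Nat.succ_le_succ T.card_vars_le_length))
      obtain ⟨hneg, hsat⟩ := (isHypothesis_hypothesis T Xs).saturate_spec he
      have h3 := hle _ (hXs.refine hneg hsat)
      have h4 := progress_lt_refine T (saturate T Xs e.ant) Xs
      refine ⟨by omega, (hXs.triple_round h0 h1 he h2).mono le_rfl ?_⟩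
      rintro s' ⟨Ys, hYs, hlt, h⟩
      have := hle Ys hYs
      exact ⟨T.length * (T.length + 1) - progress Ys, by omega, Ys, hYs, by omega, h⟩
  · rintro s ⟨hnil, j, Xs, hXs, -, h0, h1, h2⟩
    refine (hXs.triple_hypothesis h0 h1).seq fun s' hs' => Triple.copy ⟨hypothesis T Xs, ?_, ?_, ?_⟩
    · simp [hs'.2.2]
    · rcases h2 with h2 | ⟨e, -, h2⟩
      · exact h2.2
      · simp [hnil] at h2
    · simpa [hs'.2.2] using hXs.size_hypothesis_le

theorem good_initial_learner (T : HornSentence n) :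
    Good (hornFromEntailments n) T (fun c =>
      (∃ H : HornSentence n, c.reg 0 = HornSentence.encode H ∧
        (hornFromEntailments n).concept H = (hornFromEntailments n).concept T) ∧
      c.time + (c.reg 0).size ≤ learnTime T.length) (initial learner (.ofNat n)) := by
  refine triple_learner T _ [] 0 0 fun s' t' m' ht ⟨H, hH, hc, hsize⟩ => .halt _ rfl ⟨⟨H, hH, hc⟩, ?_⟩
  have : hypothesisSize T.length ≤ learnTime T.length := by rw [learnTime]; omega
  simp only
  omega

end Learner
end HornLearning

theorem mainTheorem4 :
    HornLearning.PolyTimeExactlyLearnable HornLearning.hornFromEntailments := by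
  -- The counterexample variable does not occur: encoded clauses have size linear in `n`, and `n ≤
  -- |T|`.
  refine ⟨HornLearning.learner, HornLearning.learnTime (MvPolynomial.X 0), fun n T => ?_⟩
  have hgood := HornLearning.good_initial_learner (n := n) T
  refine ⟨hgood.not_infinite, fun c hc => ?_⟩
  have hgc := hgood.of_reflTransGen hc
  rw [HornLearning.eval_learnTime]
  refine ⟨hgc.time_le fun c' h => (Nat.le_add_right _ _).trans h.2, fun hs => ?_⟩
  obtain ⟨h1, h2, h3⟩ := hgc.of_stuck hs
  exact ⟨h1, h2, h3⟩
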